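/- Let $p>2$ be a prime and let $\Gamma_2$ be the Honda formal group law of height $2$ over $\mathbb{F}_p$: the reduction modulo $p$ of the formal group law over $\mathbb{Z}_p$ with logarithm $\sum_{k\ge 0} x^{p^{2k}}/p^k$ (it is the $p$-typical formal group law over $\mathbb{F}_p$ with $p$-series $[p](x)=x^{p^2}$). Let $\mathrm{End}(\Gamma_2)$ be its ring of endomorphisms over $\mathbb{F}_{p^2}$ (formal sum as addition, composition as multiplication), with the topology of coefficientwise convergence, and let $\mathrm{Aut}(\Gamma_2)=\mathrm{End}(\Gamma_2)^\times$. The power series $ax$, $a\in\mathbb{F}_{p^2}$, are endomorphisms, and the closed subring they generate is a copy of the Witt vectors $W=W(\mathbb{F}_{p^2})$. For $g\in\mathrm{Aut}(\Gamma_2)$ let $\det(g)\in W$ be the determinant of the $W$-linear map $f\mapsto f\circ g$ of $\mathrm{End}(\Gamma_2)$. Let $S_2=\{f\in\mathrm{Aut}(\Gamma_2) : f'(0)=1\}$ and $S_2^1=\{f\in S_2 : \det(f)=1\}$. Let $H^\ast(S_2^1,\mathbb{F}_{p^2})$ be continuous cohomology with trivial discrete coefficients, and let $a\in\mathbb{F}_{p^2}^\times$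 act on it by sending a $1$-cocycle $\varphi$ to $f\mapsto\varphi(a^{-1}f(ax))$. For an integer $t$ let $\mathbb{F}_{p^2}(t)$ be $\mathbb{F}_{p^2}$ with $a\in\mathbb{F}_{p^2}^\times$ acting as multiplication by $a^t$. Every $f\in S_2^1$ can be written as $$f(x)=a_0x+_{\Gamma_2}a_1x^p+_{\Gamma_2}a_2x^{p^2}+_{\Gamma_2}\cdots ,\qquad a_i\in\mathbb{F}_{p^2},$$ and there are continuous functions $\tau_1,\tau_2,\sigma:S_2^1\to\mathbb{F}_{p^2}$ with $\tau_1(f)=a_1$, $\tau_2(f)=a_1^p$ and $\sigma(f)=a_2$ for every such expansion. The functions $\tau_1$ and $\tau_2$ are $1$-cocycles, and there is an isomorphism of $\mathbb{F}_{p^2}$-linear $\mathbb{F}_{p^2}^\times$-modules $$H^1(S_2^1,\mathbb{F}_{p^2})\cong\mathbb{F}_{p^2}(p-1)\oplus\mathbb{F}_{p^2}(p^2-p)$$ under which the generators $(1,0)$ and $(0,1)$ of the two summands correspond to $\tau_1$ and $\tau_2$ respectively. Furthermore $\tau_1\tau_2=0$ in $H^2(S_2^1,\mathbb{F}_{p^2})$;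 in fact $\partial\sigma=-\tau_1\tau_2$ as $2$-cochains, where $(\tau_1\tau_2)(f,g)=\tau_1(f)\tau_2(g)$ and $(\partial\sigma)(f,g)=\sigma(g)-\sigma(f\circ g)+\sigma(f)$. -/

import Mathlib

noncomputable section

namespace FormalGroup

variable {R : Type*} [CommRing R]

theorem hasSubst_of_zero {f : PowerSeries R} (hf : PowerSeries.constantCoeff f = 0) :
    PowerSeries.HasSubst f :=
  PowerSeries.HasSubst.of_constantCoeff_zero' hf

theorem hasSubst_pair {σ : Type*} {a b : MvPowerSeries σ R} (ha : PowerSeries.HasSubst a)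
    (hb : PowerSeries.HasSubst b) : MvPowerSeries.HasSubst ![a, b] :=
  MvPowerSeries.hasSubst_of_constantCoeff_nilpotent fun s => by
    fin_cases s
    · exact ha
    · exact hb

theorem subst_pair_subst {σ τ : Type*} {a b : MvPowerSeries σ R} (G : MvPowerSeries (Fin 2) R)
    (ha : PowerSeries.HasSubst a) (hb : PowerSeries.HasSubst b) {c : σ → MvPowerSeries τ R}
    (hc : MvPowerSeries.HasSubst c) :
    (G.subst ![a, b]).subst c = G.subst ![a.subst c, b.subst c] := by
  rw [MvPowerSeries.subst_comp_subst_apply (hasSubst_pair ha hb) hc]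
  congr 1
  funext s
  fin_cases s <;> rfl

theorem hasSubst_subst {σ : Type*} {f : PowerSeries R} (hf : PowerSeries.constantCoeff f = 0)
    {a : MvPowerSeries σ R} (ha : PowerSeries.HasSubst a) : PowerSeries.HasSubst (f.subst a) :=
  MvPowerSeries.IsNilpotent_subst ha.const (by
    rw [show MvPowerSeries.constantCoeff f = 0 from hf]; exact IsNilpotent.zero)

theorem constantCoeff_subst_zero {f g : PowerSeries R} (hf : PowerSeries.constantCoeff f = 0)
    (hg : PowerSeries.constantCoeff g = 0) : PowerSeries.constantCoeff (f.subst g) = 0 :=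
  PowerSeries.constantCoeff_subst_eq_zero (a := g) hg f hf

theorem constantCoeff_pair {G : MvPowerSeries (Fin 2) R} (hG : G.constantCoeff = 0)
    {a b : PowerSeries R} (ha : PowerSeries.constantCoeff a = 0)
    (hb : PowerSeries.constantCoeff b = 0) :
    PowerSeries.constantCoeff (G.subst ![a, b] : PowerSeries R) = 0 :=
  MvPowerSeries.constantCoeff_subst_eq_zero
    (hasSubst_pair (hasSubst_of_zero ha) (hasSubst_of_zero hb))
    (fun s => by fin_cases s <;> assumption) hG

/-! ### Congruences modulo a power of the variable -/

theorem dvd_mul_sub {S : Type*} [CommRing S] {d a a' b b' : S} (ha : d ∣ a - a')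
    (hb : d ∣ b - b') : d ∣ a * b - a' * b' := by
  have : a * b - a' * b' = (a - a') * b + a' * (b - b') := by ring
  rw [this]
  exact dvd_add (ha.mul_right b) (hb.mul_left a')

theorem dvd_pair_sub {n : ℕ} (G : MvPowerSeries (Fin 2) R) {a a' b b' : PowerSeries R}
    (ha : PowerSeries.constantCoeff a = 0) (ha' : PowerSeries.constantCoeff a' = 0)
    (hb : PowerSeries.constantCoeff b = 0) (hb' : PowerSeries.constantCoeff b' = 0)
    (haa : PowerSeries.X ^ n ∣ a - a') (hbb : PowerSeries.X ^ n ∣ b - b') :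
    (PowerSeries.X ^ n : PowerSeries R) ∣
      (G.subst ![a, b] : PowerSeries R) - (G.subst ![a', b'] : PowerSeries R) := by
  rw [PowerSeries.X_pow_dvd_iff]
  intro m hm
  rw [map_sub, sub_eq_zero, PowerSeries.coeff,
    MvPowerSeries.coeff_subst (hasSubst_pair (hasSubst_of_zero ha) (hasSubst_of_zero hb)),
    MvPowerSeries.coeff_subst (hasSubst_pair (hasSubst_of_zero ha') (hasSubst_of_zero hb'))]
  refine finsum_congr fun d => ?_
  congr 1
  have key : (PowerSeries.X ^ n : PowerSeries R) ∣ a ^ d 0 * b ^ d 1 - a' ^ d 0 * b' ^ d 1 :=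
    dvd_mul_sub (haa.trans (sub_dvd_pow_sub_pow _ _ _)) (hbb.trans (sub_dvd_pow_sub_pow _ _ _))
  have h := PowerSeries.X_pow_dvd_iff.1 key m hm
  rw [map_sub, sub_eq_zero, PowerSeries.coeff] at h
  simpa [Finsupp.prod_fintype] using h

theorem dvd_subst_sub {n : ℕ} {f f' g g' : PowerSeries R}
    (hg : PowerSeries.constantCoeff g = 0) (hg' : PowerSeries.constantCoeff g' = 0)
    (hff : PowerSeries.X ^ n ∣ f - f') (hgg : PowerSeries.X ^ n ∣ g - g') :
    (PowerSeries.X ^ n : PowerSeries R) ∣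
      (f.subst g : PowerSeries R) - (f'.subst g' : PowerSeries R) := by
  rw [PowerSeries.X_pow_dvd_iff]
  intro m hm
  rw [map_sub, sub_eq_zero, PowerSeries.coeff_subst' (hasSubst_of_zero hg),
    PowerSeries.coeff_subst' (hasSubst_of_zero hg')]
  refine finsum_congr fun d => ?_
  have h := PowerSeries.X_pow_dvd_iff.1 (hgg.trans (sub_dvd_pow_sub_pow g g' d)) m hm
  rw [map_sub, sub_eq_zero] at h
  rw [h]
  by_cases hd : d < n
  · have h' := PowerSeries.X_pow_dvd_iff.1 hff d hd
    rw [map_sub, sub_eq_zero] at h'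
    rw [h']
  · have hX : (PowerSeries.X ^ d : PowerSeries R) ∣ g' ^ d :=
      pow_dvd_pow_of_dvd (PowerSeries.X_dvd_iff.2 hg') d
    rw [PowerSeries.X_pow_dvd_iff.1 hX m (by omega)]
    simp

/-! ### The formal inverse -/

variable (F : FormalGroup R)

theorem coeff_single_zero (n : ℕ) :
    F.toPowerSeries.coeff (Finsupp.single 0 n) = if n = 1 then 1 else 0 := by
  have h := congrArg (PowerSeries.coeff n) F.Xzero_eq_X
  rw [PowerSeries.coeff_X] at h
  rw [← h, PowerSeries.coeff, Xzero, MvPowerSeries.coeff_subst (hasSubst_pair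
      PowerSeries.HasSubst.X' PowerSeries.HasSubst.zero'),
    finsum_eq_single _ (Finsupp.single 0 n)]
  · have : (PowerSeries.coeff n) (PowerSeries.X ^ n : PowerSeries R) = 1 := by
      simp [PowerSeries.coeff_X_pow]
    rw [PowerSeries.coeff] at this
    simp [Finsupp.prod_fintype, this]
  · intro d hd
    by_cases h1 : d 1 = 0
    · have h0 : n ≠ d 0 := by
        rintro rfl
        apply hd
        ext s
        fin_cases s <;> simp [h1]
      have : (PowerSeries.coeff n) (PowerSeries.X ^ d 0 : PowerSeries R) = 0 := by
        simp [PowerSeries.coeff_X_pow, h0]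
      rw [PowerSeries.coeff] at this
      simp [Finsupp.prod_fintype, h1, this]
    · simp [Finsupp.prod_fintype, h1]

theorem coeff_single_one (n : ℕ) :
    F.toPowerSeries.coeff (Finsupp.single 1 n) = if n = 1 then 1 else 0 := by
  have h := congrArg (PowerSeries.coeff n) F.zeroX_eq_X
  rw [PowerSeries.coeff_X] at h
  rw [← h, PowerSeries.coeff, zeroX, MvPowerSeries.coeff_subst (hasSubst_pair
      PowerSeries.HasSubst.zero' PowerSeries.HasSubst.X'),
    finsum_eq_single _ (Finsupp.single 1 n)]
  · have : (PowerSeries.coeff n) (PowerSeries.X ^ n : PowerSeries R) = 1 := by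
      simp [PowerSeries.coeff_X_pow]
    rw [PowerSeries.coeff] at this
    simp [Finsupp.prod_fintype, this]
  · intro d hd
    by_cases h1 : d 0 = 0
    · have h0 : n ≠ d 1 := by
        rintro rfl
        apply hd
        ext s
        fin_cases s <;> simp [h1]
      have : (PowerSeries.coeff n) (PowerSeries.X ^ d 1 : PowerSeries R) = 0 := by
        simp [PowerSeries.coeff_X_pow, h0]
      rw [PowerSeries.coeff] at this
      simp [Finsupp.prod_fintype, h1, this]
    · simp [Finsupp.prod_fintype, h1]

theorem exists_eq_add_mul : ∃ H : MvPowerSeries (Fin 2) R, ∀ {a b : PowerSeries R},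
    PowerSeries.constantCoeff a = 0 → PowerSeries.constantCoeff b = 0 →
    (F.toPowerSeries.subst ![a, b] : PowerSeries R) =
      a + b + a * b * (H.subst ![a, b] : PowerSeries R) := by
  have h0 : (MvPowerSeries.X 0 : MvPowerSeries (Fin 2) R) ∣
      F.toPowerSeries - MvPowerSeries.X 0 - MvPowerSeries.X 1 := by
    rw [MvPowerSeries.X_dvd_iff]
    intro m hm
    obtain ⟨n, rfl⟩ : ∃ n, m = Finsupp.single 1 n :=
      ⟨m 1, by ext s; fin_cases s <;> simp [hm]⟩
    rw [map_sub, map_sub, F.coeff_single_one, MvPowerSeries.coeff_X,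
      MvPowerSeries.coeff_X]
    by_cases hn : n = 1 <;> simp [hn, Finsupp.single_left_inj, Finsupp.single_eq_single_iff]
  obtain ⟨H0, hH0⟩ := h0
  have h1 : (MvPowerSeries.X 1 : MvPowerSeries (Fin 2) R) ∣ H0 := by
    rw [MvPowerSeries.X_dvd_iff]
    intro m hm
    obtain ⟨n, rfl⟩ : ∃ n, m = Finsupp.single 0 n :=
      ⟨m 0, by ext s; fin_cases s <;> simp [hm]⟩
    have h := congrArg (MvPowerSeries.coeff (Finsupp.single 0 (n + 1))) hH0
    rw [add_comm n 1, Finsupp.single_add, MvPowerSeries.X, MvPowerSeries.coeff_add_monomial_mul,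
      one_mul, ← Finsupp.single_add, map_sub, map_sub, F.coeff_single_zero] at h
    rw [← h, ← MvPowerSeries.X, MvPowerSeries.coeff_X, MvPowerSeries.coeff_X]
    simp only [Finsupp.single_eq_single_iff]
    by_cases hn : n = 0 <;> simp [hn]
  obtain ⟨H, hH⟩ := h1
  refine ⟨H, fun {a b} ha hb => ?_⟩
  have hab := hasSubst_pair (hasSubst_of_zero ha) (hasSubst_of_zero hb)
  have hF : F.toPowerSeries = MvPowerSeries.X 0 + MvPowerSeries.X 1 +
      MvPowerSeries.X 0 * (MvPowerSeries.X 1 * H) := by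
    rw [← hH, ← hH0]; ring
  rw [hF, MvPowerSeries.subst_add hab, MvPowerSeries.subst_add hab, MvPowerSeries.subst_mul hab,
    MvPowerSeries.subst_mul hab, MvPowerSeries.subst_X hab, MvPowerSeries.subst_X hab]
  simp only [Matrix.cons_val_zero, Matrix.cons_val_one, Matrix.cons_val_fin_one]
  rw [mul_assoc]

theorem exists_neg : ∃ i : PowerSeries R, PowerSeries.constantCoeff i = 0 ∧
    (F.toPowerSeries.subst ![PowerSeries.X, i] : PowerSeries R) = 0 := by
  obtain ⟨H, hH⟩ := F.exists_eq_add_mul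
  have hX : PowerSeries.constantCoeff (PowerSeries.X : PowerSeries R) = 0 := by simp
  have hS : ∀ {f : PowerSeries R}, PowerSeries.constantCoeff f = 0 → PowerSeries.HasSubst f :=
    fun h => hasSubst_of_zero h
  let P : Type _ := {f : PowerSeries R // PowerSeries.constantCoeff f = 0}
  let δ : P → PowerSeries R := fun g => F.toPowerSeries.subst ![PowerSeries.X, g.1]
  have hδ : ∀ g, PowerSeries.constantCoeff (δ g) = 0 := fun g =>
    constantCoeff_pair F.zero_constantCoeff hX g.2
  have hδ' : ∀ g, PowerSeries.constantCoeff (-δ g) = 0 := fun g => by simp [hδ g]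
  let next : P → P := fun g => ⟨F.toPowerSeries.subst ![g.1, -δ g],
    constantCoeff_pair F.zero_constantCoeff g.2 (hδ' g)⟩
  let g : ℕ → P := fun n => next^[n] ⟨0, by simp⟩
  have hg : ∀ n, g (n + 1) = next (g n) := fun n => Function.iterate_succ_apply' next n _
  have hstep : ∀ n, δ (g (n + 1)) = F.toPowerSeries.subst ![δ (g n), -δ (g n)] := by
    intro n
    rw [hg]
    exact (F.assoc' (hS hX) (hS (g n).2) (hS (hδ' (g n)))).symm
  have hdvd : ∀ n, PowerSeries.X ^ (n + 1) ∣ δ (g n) := by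
    intro n
    induction n with
    | zero => simpa using PowerSeries.X_dvd_iff.2 (hδ (g 0))
    | succ n ih =>
      rw [hstep, hH (hδ _) (hδ' _)]
      have h1 : (PowerSeries.X : PowerSeries R) ∣ -δ (g n) := PowerSeries.X_dvd_iff.2 (hδ' _)
      rw [add_neg_cancel, _root_.zero_add, pow_succ]
      exact (mul_dvd_mul ih h1).mul_right _
  have hdiff : ∀ n, PowerSeries.X ^ (n + 1) ∣ (g (n + 1)).1 - (g n).1 := by
    intro n
    rw [hg]
    change _ ∣ (F.toPowerSeries.subst ![(g n).1, -δ (g n)] : PowerSeries R) - (g n).1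
    rw [hH (g n).2 (hδ' _)]
    have : (g n).1 + -δ (g n) + (g n).1 * -δ (g n) * (H.subst ![(g n).1, -δ (g n)] : PowerSeries R)
        - (g n).1 = δ (g n) *
        (-1 - (g n).1 * (H.subst ![(g n).1, -δ (g n)] : PowerSeries R)) := by ring
    rw [this]
    exact (hdvd n).mul_right _
  have hle : ∀ m n, m ≤ n → PowerSeries.X ^ (m + 1) ∣ (g n).1 - (g m).1 := by
    intro m n hmn
    induction n, hmn using Nat.le_induction with
    | base => simp
    | succ n hmn ih =>
      have := dvd_add ((pow_dvd_pow PowerSeries.X (Nat.succ_le_succ hmn)).trans (hdiff n)) ih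
      simpa using this
  let i : PowerSeries R := PowerSeries.mk fun n => PowerSeries.coeff n (g n).1
  have hi : ∀ n, PowerSeries.X ^ (n + 1) ∣ i - (g n).1 := by
    intro n
    rw [PowerSeries.X_pow_dvd_iff]
    intro m hm
    have := PowerSeries.X_pow_dvd_iff.1 (hle m n (by omega)) m (by omega)
    rw [map_sub, sub_eq_zero] at this
    simp [i, this]
  have hi0 : PowerSeries.constantCoeff i = 0 := by
    have := (g 0).2
    rw [← PowerSeries.coeff_zero_eq_constantCoeff_apply] at this ⊢
    simpa [i] using this
  refine ⟨i, hi0, ?_⟩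
  ext n
  have h := dvd_pair_sub F.toPowerSeries hX hX hi0 (g n).2 (n := n + 1) (by simp) (hi n)
  have h' := dvd_add h (hdvd n)
  rw [sub_add_cancel] at h'
  simpa using PowerSeries.X_pow_dvd_iff.1 h' n (by omega)

/-! ### The endomorphism ring of a commutative formal group law -/

/-- An endomorphism of a formal group law `F` over `R`: a power series `f` over `R` with `f(0) = 0`
and `f(F(x, y)) = F(f(x), f(y))`. -/
@[ext]
structure Endo where
  /-- The underlying power series. -/
  series : PowerSeries R
  constantCoeff_series : PowerSeries.constantCoeff series = 0
  series_add : series.subst F.toPowerSeries =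
    F.toPowerSeries.subst
      ![series.subst (MvPowerSeries.X 0 : MvPowerSeries (Fin 2) R),
        series.subst (MvPowerSeries.X 1 : MvPowerSeries (Fin 2) R)]

namespace Endo

variable {F}

theorem hasSubst (f : F.Endo) : PowerSeries.HasSubst f.series :=
  hasSubst_of_zero f.constantCoeff_series

theorem hasSubst_F : PowerSeries.HasSubst F.toPowerSeries :=
  PowerSeries.HasSubst.of_constantCoeff_zero F.zero_constantCoeff

/-- An endomorphism acts on the points of the formal group by a homomorphism. -/
theorem subst_add {σ : Type*} (f : F.Endo) {a b : MvPowerSeries σ R}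
    (ha : PowerSeries.HasSubst a) (hb : PowerSeries.HasSubst b) :
    f.series.subst (F.toPowerSeries.subst ![a, b]) =
      F.toPowerSeries.subst ![f.series.subst a, f.series.subst b] := by
  have hab := hasSubst_pair ha hb
  have h := congrArg (MvPowerSeries.subst ![a, b]) f.series_add
  have hX : ∀ s : Fin 2, PowerSeries.HasSubst (MvPowerSeries.X s : MvPowerSeries (Fin 2) R) :=
    fun s => PowerSeries.HasSubst.X s
  rw [subst_pair_subst _ (hasSubst_subst f.constantCoeff_series (hX 0))
    (hasSubst_subst f.constantCoeff_series (hX 1)) hab] at h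
  have key : ∀ {c : MvPowerSeries (Fin 2) R}, PowerSeries.HasSubst c →
      (f.series.subst c).subst ![a, b] = f.series.subst (c.subst ![a, b]) := fun hc =>
    MvPowerSeries.subst_comp_subst_apply hc.const hab f.series
  rw [key hasSubst_F, key (hX 0), key (hX 1), MvPowerSeries.subst_X hab,
    MvPowerSeries.subst_X hab] at h
  exact h

/-- Composition of power series is associative. -/
theorem comp_subst {σ : Type*} (f : PowerSeries R) {g : PowerSeries R}
    (hg : PowerSeries.constantCoeff g = 0) {a : MvPowerSeries σ R} (ha : PowerSeries.HasSubst a) :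
    PowerSeries.subst a (f.subst g : PowerSeries R) = f.subst (g.subst a) :=
  PowerSeries.subst_comp_subst_apply (hasSubst_of_zero hg) ha f

/-- Substitution into a formal sum of power series. -/
theorem pair_subst {σ : Type*} (G : MvPowerSeries (Fin 2) R) {f g : PowerSeries R}
    (hf : PowerSeries.constantCoeff f = 0) (hg : PowerSeries.constantCoeff g = 0)
    {a : MvPowerSeries σ R} (ha : PowerSeries.HasSubst a) :
    PowerSeries.subst a (G.subst ![f, g] : PowerSeries R) = G.subst ![f.subst a, g.subst a] :=
  subst_pair_subst G (hasSubst_of_zero hf) (hasSubst_of_zero hg) ha.const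

instance : Zero F.Endo where
  zero :=
    { series := 0
      constantCoeff_series := map_zero _
      series_add := by
        have h0 : ∀ {σ : Type} {a : MvPowerSeries σ R}, PowerSeries.HasSubst a →
            (0 : PowerSeries R).subst a = 0 := fun ha => by
          rw [← PowerSeries.coe_substAlgHom ha, map_zero]
        rw [h0 hasSubst_F, h0 (PowerSeries.HasSubst.X 0), h0 (PowerSeries.HasSubst.X 1),
          F.add_zero PowerSeries.HasSubst.zero] }

instance : One F.Endo where
  one :=
    { series := PowerSeries.X
      constantCoeff_series := by simp
      series_add := by
        rw [PowerSeries.subst_X hasSubst_F, PowerSeries.subst_X (PowerSeries.HasSubst.X 0),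
          PowerSeries.subst_X (PowerSeries.HasSubst.X 1)]
        conv_lhs => rw [← id_eq F.toPowerSeries, ← MvPowerSeries.subst_self]
        congr 1
        funext s
        fin_cases s <;> rfl }

/-- The product of two endomorphisms is their composite `f(g(x))`. -/
instance : Mul F.Endo where
  mul f g :=
    { series := f.series.subst g.series
      constantCoeff_series :=
        constantCoeff_subst_zero f.constantCoeff_series g.constantCoeff_series
      series_add := by
        rw [comp_subst _ g.constantCoeff_series hasSubst_F, g.series_add,
          f.subst_add (hasSubst_subst g.constantCoeff_series (PowerSeries.HasSubst.X 0))
            (hasSubst_subst g.constantCoeff_series (PowerSeries.HasSubst.X 1)),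
          comp_subst _ g.constantCoeff_series (PowerSeries.HasSubst.X 0),
          comp_subst _ g.constantCoeff_series (PowerSeries.HasSubst.X 1)] }

/-- A power series with nilpotent constant coefficient, as a point of the formal group. -/
abbrev point {σ : Type*} (F : FormalGroup R) (a : MvPowerSeries σ R)
    (ha : PowerSeries.HasSubst a) : F.Point σ :=
  ⟨a, ha⟩

/-- The formal sum of four points does not depend on the order of the middle terms. -/
theorem add_add_add_comm [F.IsComm] {σ : Type*} {a b c d : MvPowerSeries σ R}
    (ha : PowerSeries.HasSubst a) (hb : PowerSeries.HasSubst b) (hc : PowerSeries.HasSubst c)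
    (hd : PowerSeries.HasSubst d) :
    F.toPowerSeries.subst ![F.toPowerSeries.subst ![a, b], F.toPowerSeries.subst ![c, d]] =
      F.toPowerSeries.subst ![F.toPowerSeries.subst ![a, c], F.toPowerSeries.subst ![b, d]] :=
  congrArg Subtype.val
    (_root_.add_add_add_comm (point F a ha) (point F b hb) (point F c hc) (point F d hd))

/-- The sum of two endomorphisms is their formal sum `F(f(x), g(x))`. -/
instance [F.IsComm] : Add F.Endo where
  add f g :=
    { series := F.toPowerSeries.subst ![f.series, g.series]
      constantCoeff_series := constantCoeff_pair F.zero_constantCoeff f.constantCoeff_series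
        g.constantCoeff_series
      series_add := by
        have hf := f.constantCoeff_series
        have hg := g.constantCoeff_series
        have h0 := PowerSeries.HasSubst.X (S := R) (0 : Fin 2)
        have h1 := PowerSeries.HasSubst.X (S := R) (1 : Fin 2)
        rw [pair_subst _ hf hg hasSubst_F, pair_subst _ hf hg h0, pair_subst _ hf hg h1,
          f.series_add, g.series_add]
        exact add_add_add_comm (hasSubst_subst hf h0) (hasSubst_subst hf h1)
          (hasSubst_subst hg h0) (hasSubst_subst hg h1) }

variable (F) in
/-- The formal inverse of `F`: the power series `i` with `F(x, i(x)) = 0`. -/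
def inverse : PowerSeries R := F.exists_neg.choose

theorem constantCoeff_inverse : PowerSeries.constantCoeff (inverse F) = 0 :=
  F.exists_neg.choose_spec.1

theorem add_inverse {σ : Type*} {a : MvPowerSeries σ R} (ha : PowerSeries.HasSubst a) :
    F.toPowerSeries.subst ![a, (inverse F).subst a] = 0 := by
  have h := congrArg (PowerSeries.subst a) F.exists_neg.choose_spec.2
  rw [pair_subst _ (by simp) F.exists_neg.choose_spec.1 ha, PowerSeries.subst_X ha] at h
  rw [inverse, h, ← PowerSeries.coe_substAlgHom ha, map_zero]

theorem eq_inverse [F.IsComm] {σ : Type*} {a b : MvPowerSeries σ R} (ha : PowerSeries.HasSubst a)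
    (hb : PowerSeries.HasSubst b) (h : F.toPowerSeries.subst ![a, b] = 0) :
    b = (inverse F).subst a := by
  have hi := hasSubst_subst constantCoeff_inverse ha (f := inverse F)
  have h' : point F b hb + point F a ha = 0 := by
    rw [add_comm]; exact Subtype.ext h
  have h'' : point F a ha + point F _ hi = 0 := Subtype.ext (add_inverse ha)
  exact congrArg Subtype.val (left_neg_eq_right_neg (M := F.Point σ) h' h'')

instance [F.IsComm] : Neg F.Endo where
  neg f :=
    { series := (inverse F).subst f.series
      constantCoeff_series := constantCoeff_subst_zero constantCoeff_inverse f.constantCoeff_series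
      series_add := by
        have hf := f.constantCoeff_series
        have h0 := hasSubst_subst hf (PowerSeries.HasSubst.X (S := R) (0 : Fin 2))
        have h1 := hasSubst_subst hf (PowerSeries.HasSubst.X (S := R) (1 : Fin 2))
        have hi0 := hasSubst_subst constantCoeff_inverse h0 (f := inverse F)
        have hi1 := hasSubst_subst constantCoeff_inverse h1 (f := inverse F)
        have hadd : ∀ {a b : MvPowerSeries (Fin 2) R}, PowerSeries.HasSubst a →
            PowerSeries.HasSubst b → PowerSeries.HasSubst (F.toPowerSeries.subst ![a, b]) :=
          fun ha hb => MvPowerSeries.IsNilpotent_subst (hasSubst_pair ha hb) (by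
            rw [F.zero_constantCoeff]; exact IsNilpotent.zero)
        rw [comp_subst _ hf hasSubst_F, comp_subst _ hf (PowerSeries.HasSubst.X 0),
          comp_subst _ hf (PowerSeries.HasSubst.X 1), f.series_add]
        symm
        refine eq_inverse (hadd h0 h1) (hadd hi0 hi1) ?_
        rw [add_add_add_comm h0 h1 hi0 hi1, add_inverse h0, add_inverse h1,
          F.add_zero PowerSeries.HasSubst.zero] }

@[simp] theorem series_zero : (0 : F.Endo).series = 0 := rfl

@[simp] theorem series_one : (1 : F.Endo).series = PowerSeries.X := rfl

@[simp] theorem series_mul (f g : F.Endo) : (f * g).series = f.series.subst g.series := rfl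

@[simp] theorem series_sum [F.IsComm] (f g : F.Endo) :
    (f + g).series = F.toPowerSeries.subst ![f.series, g.series] := rfl

@[simp] theorem series_neg [F.IsComm] (f : F.Endo) :
    (-f).series = (inverse F).subst f.series := rfl

/-- The ring of endomorphisms of a commutative formal group law, with formal sum as addition and
composition as multiplication. -/
instance [F.IsComm] : Ring F.Endo where
  add_assoc f g h := Endo.ext (F.assoc' f.hasSubst g.hasSubst h.hasSubst)
  zero_add f := Endo.ext (F.zero_add f.hasSubst)
  add_zero f := Endo.ext (F.add_zero f.hasSubst)
  add_comm f g := Endo.ext (F.comm' f.hasSubst g.hasSubst)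
  nsmul := nsmulRec
  zsmul := zsmulRec
  neg_add_cancel f := Endo.ext (by
    rw [series_sum, F.comm' (-f).hasSubst f.hasSubst]
    exact add_inverse f.hasSubst)
  mul_assoc f g h := Endo.ext (comp_subst f.series g.constantCoeff_series h.hasSubst)
  one_mul f := Endo.ext (PowerSeries.subst_X f.hasSubst)
  mul_one f := Endo.ext (PowerSeries.X_subst f.series)
  zero_mul f := Endo.ext (by
    rw [series_mul, series_zero, ← PowerSeries.coe_substAlgHom f.hasSubst, map_zero])
  mul_zero f := Endo.ext (PowerSeries.subst_zero_of_constantCoeff_zero f.constantCoeff_series)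
  left_distrib f g h := Endo.ext (f.subst_add g.hasSubst h.hasSubst)
  right_distrib f g h := Endo.ext
    (pair_subst _ f.constantCoeff_series g.constantCoeff_series h.hasSubst)

/-! ### The topology of the endomorphism ring -/

/-- The topology of coefficientwise convergence on the endomorphism ring, the coefficients being
discrete: two endomorphisms are close if they agree modulo a high power of `x`. -/
instance : TopologicalSpace F.Endo :=
  TopologicalSpace.induced (fun f (n : ℕ) => PowerSeries.coeff n f.series)
    (@Pi.topologicalSpace ℕ (fun _ => R) fun _ => ⊥)

theorem mem_nhds_iff (f : F.Endo) (s : Set F.Endo) :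
    s ∈ nhds f ↔ ∃ n : ℕ, ∀ g : F.Endo, PowerSeries.X ^ n ∣ g.series - f.series → g ∈ s := by
  let _ : TopologicalSpace R := ⊥
  have : DiscreteTopology R := ⟨rfl⟩
  rw [nhds_induced, Filter.mem_comap, nhds_pi]
  constructor
  · rintro ⟨t, ht, hts⟩
    rw [Filter.mem_pi] at ht
    obtain ⟨I, hI, u, hu, hut⟩ := ht
    obtain ⟨N, hN⟩ := hI.bddAbove
    refine ⟨N + 1, fun g hg => hts (hut fun i hi => ?_)⟩
    have h := PowerSeries.X_pow_dvd_iff.1 hg i (Nat.lt_succ_of_le (hN hi))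
    rw [map_sub, sub_eq_zero] at h
    change PowerSeries.coeff i g.series ∈ u i
    rw [h]
    exact mem_of_mem_nhds (hu i)
  · rintro ⟨n, hn⟩
    refine ⟨(Set.Iio n).pi fun i => {PowerSeries.coeff i f.series},
      Filter.pi_mem_pi (Set.finite_Iio n) fun i _ => by simp, fun g hg => hn g ?_⟩
    rw [PowerSeries.X_pow_dvd_iff]
    intro m hm
    rw [map_sub, sub_eq_zero]
    exact hg m hm

theorem nhds_mem (f : F.Endo) (n : ℕ) :
    {g : F.Endo | PowerSeries.X ^ n ∣ g.series - f.series} ∈ nhds f :=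
  (mem_nhds_iff f _).2 ⟨n, fun _ h => h⟩

instance : T2Space F.Endo := by
  let _ : TopologicalSpace R := ⊥
  have : DiscreteTopology R := ⟨rfl⟩
  refine T2Space.of_injective_continuous (Y := ℕ → R)
    (f := fun (f : F.Endo) (n : ℕ) => PowerSeries.coeff n f.series) (fun f g h => ?_)
    continuous_induced_dom
  exact Endo.ext (PowerSeries.ext fun n => congrFun h n)

instance : ContinuousMul F.Endo where
  continuous_mul := continuous_iff_continuousAt.2 fun ⟨f, g⟩ s hs => by
    obtain ⟨n, hn⟩ := (mem_nhds_iff _ s).1 hs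
    refine Filter.mem_map.2 (Filter.mem_of_superset (prod_mem_nhds (nhds_mem f n) (nhds_mem g n)) ?_)
    rintro ⟨f', g'⟩ ⟨hf, hg⟩
    exact hn _ (dvd_subst_sub g'.constantCoeff_series g.constantCoeff_series hf hg)

instance [F.IsComm] : IsTopologicalRing F.Endo where
  continuous_mul := continuous_mul
  continuous_add := continuous_iff_continuousAt.2 fun ⟨f, g⟩ s hs => by
    obtain ⟨n, hn⟩ := (mem_nhds_iff _ s).1 hs
    refine Filter.mem_map.2 (Filter.mem_of_superset (prod_mem_nhds (nhds_mem f n) (nhds_mem g n)) ?_)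
    rintro ⟨f', g'⟩ ⟨hf, hg⟩
    exact hn _ (dvd_pair_sub F.toPowerSeries f'.constantCoeff_series f.constantCoeff_series
      g'.constantCoeff_series g.constantCoeff_series hf hg)
  continuous_neg := continuous_iff_continuousAt.2 fun f s hs => by
    obtain ⟨n, hn⟩ := (mem_nhds_iff _ s).1 hs
    refine Filter.mem_map.2 (Filter.mem_of_superset (nhds_mem f n) fun g hg => hn _ ?_)
    exact dvd_subst_sub g.constantCoeff_series f.constantCoeff_series (by simp) hg

end Endo

/-! ### Formal sums -/

/-- The term `a xᵐ` as a point of the formal group, for `m ≥ 1` (and `0` for `m = 0`). -/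
def monomialPoint (a : R) (m : ℕ) : F.Point Unit :=
  if hm : m = 0 then 0 else
    ⟨PowerSeries.monomial m a, PowerSeries.HasSubst.monomial' hm a⟩

/-- `f(x) = a₀ x +_F a₁ x ^ p +_F a₂ x ^ (p ^ 2) +_F ⋯`: the partial formal sums converge
coefficientwise to `f`. -/
def IsExpansion [F.IsComm] (p : ℕ) (f : PowerSeries R) (a : ℕ → R) : Prop :=
  ∀ n : ℕ, ∀ᶠ N in Filter.atTop,
    PowerSeries.coeff n (∑ i ∈ Finset.range N, F.monomialPoint (a i) (p ^ i) : F.Point Unit).val =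
      PowerSeries.coeff n f

end FormalGroup

/-! ### The Honda formal group law of height 2 -/

namespace Honda

open MvPowerSeries Finsupp

section Coeff

variable {σ R : Type*} [CommRing R]

theorem coeff_pow_congr {n m : ℕ} {A B : MvPowerSeries σ R} (hA : A.constantCoeff = 0)
    (hB : B.constantCoeff = 0) (hAB : ∀ e : σ →₀ ℕ, e.degree < n → A.coeff e = B.coeff e)
    (hm : 2 ≤ m) {d : σ →₀ ℕ} (hd : d.degree ≤ n) : (A ^ m).coeff d = (B ^ m).coeff d := by
  classical
  rw [coeff_pow, coeff_pow]
  refine Finset.sum_congr rfl fun l hl => ?_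
  rw [Finset.mem_finsuppAntidiag] at hl
  by_cases h0 : ∃ i ∈ Finset.range m, l i = 0
  · obtain ⟨i, hi, h⟩ := h0
    rw [Finset.prod_eq_zero hi, Finset.prod_eq_zero hi]
    · rw [h]; exact hB
    · rw [h]; exact hA
  · push Not at h0
    refine Finset.prod_congr rfl fun i hi => hAB _ ?_
    obtain ⟨j, hj, hij⟩ : ∃ j ∈ Finset.range m, j ≠ i := by
      by_cases h : i = 0
      · exact ⟨1, by simp; omega, by omega⟩
      · exact ⟨0, by simp; omega, fun h' => h h'.symm⟩
    have hj' : 0 < (l j).degree := by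
      rw [Nat.pos_iff_ne_zero, Ne, Finsupp.degree_eq_zero_iff]
      exact h0 j hj
    have hsum : ∑ i ∈ Finset.range m, (l i).degree = d.degree := by
      rw [← map_sum, hl.1]
    have := Finset.sum_le_sum_of_subset (f := fun i => (l i).degree) (s := {i, j})
      (t := Finset.range m) (by intro x; simp; rintro (rfl | rfl) <;> simp_all)
    rw [Finset.sum_pair hij.symm, hsum] at this
    omega

theorem coeff_pow_eq_zero {A : MvPowerSeries σ R} (hA : A.constantCoeff = 0) {m : ℕ}
    {d : σ →₀ ℕ} (hd : d.degree < m) : (A ^ m).coeff d = 0 :=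
  coeff_of_lt_order (lt_of_lt_of_le (by exact_mod_cast hd)
    (le_order_pow_of_constantCoeff_eq_zero m hA))

theorem coeff_pow_modEq {r : ℕ} {n m : ℕ} {A : MvPowerSeries σ R} (hA : A.constantCoeff = 0)
    (h : ∀ e : σ →₀ ℕ, e.degree < n → A.coeff e ≠ 0 → e.degree ≡ 1 [MOD r])
    (hm : 2 ≤ m) {d : σ →₀ ℕ} (hd : d.degree ≤ n) (hne : (A ^ m).coeff d ≠ 0) :
    d.degree ≡ m [MOD r] := by
  classical
  let B : MvPowerSeries σ R := fun e => if e.degree < n then A.coeff e else 0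
  have hB : ∀ e, B.coeff e = if e.degree < n then A.coeff e else 0 := fun e => rfl
  have hB0 : B.constantCoeff = 0 := by
    rw [← coeff_zero_eq_constantCoeff_apply, hB, coeff_zero_eq_constantCoeff_apply, hA]
    simp
  rw [coeff_pow_congr hA hB0 (fun e he => by rw [hB, if_pos he]) hm hd, coeff_pow] at hne
  obtain ⟨l, hl, hne⟩ := Finset.exists_ne_zero_of_sum_ne_zero hne
  rw [Finset.mem_finsuppAntidiag] at hl
  have hsum : ∑ i ∈ Finset.range m, (l i).degree = d.degree := by
    rw [← map_sum, hl.1]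
  have h1 : ∀ i ∈ Finset.range m, (l i).degree ≡ 1 [MOD r] := by
    intro i hi
    have h3 : B.coeff (l i) ≠ 0 := fun h0 => hne (Finset.prod_eq_zero hi h0)
    rw [hB] at h3
    by_cases h4 : (l i).degree < n
    · rw [if_pos h4] at h3
      exact h _ h4 h3
    · rw [if_neg h4] at h3
      exact absurd rfl h3
  rw [← hsum]
  have h5 : ∑ i ∈ Finset.range m, (l i).degree ≡ ∑ i ∈ Finset.range m, 1 [MOD r] := by
    have h6 : ∀ s : Finset ℕ, s ⊆ Finset.range m →
        ∑ i ∈ s, (l i).degree ≡ ∑ i ∈ s, 1 [MOD r] := by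
      intro s
      induction s using Finset.induction_on with
      | empty => intro _; rfl
      | insert a s ha ih =>
        intro hs
        rw [Finset.sum_insert ha, Finset.sum_insert ha]
        exact (h1 a (hs (Finset.mem_insert_self a s))).add
          (ih fun x hx => hs (Finset.mem_insert_of_mem hx))
    exact h6 _ subset_rfl
  simpa using h5

end Coeff

variable (p : ℕ) [Fact p.Prime]

/-- The logarithm `x + x ^ (p ^ 2) / p + x ^ (p ^ 4) / p ^ 2 + ⋯` of the Honda formal group law of
height 2: the coefficient of `x ^ (p ^ (2 * k))` is `1 / p ^ k`, the other coefficients vanish. -/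
def log : PowerSeries ℚ_[p] :=
  PowerSeries.mk fun n =>
    if n = (p ^ 2) ^ Nat.log (p ^ 2) n then ((p : ℚ_[p]) ^ Nat.log (p ^ 2) n)⁻¹ else 0

theorem one_lt_q : 1 < p ^ 2 :=
  Nat.one_lt_pow two_ne_zero (Fact.out (p := p.Prime)).one_lt

theorem coeff_log_pow (k : ℕ) :
    PowerSeries.coeff ((p ^ 2) ^ k) (log p) = ((p : ℚ_[p]) ^ k)⁻¹ := by
  rw [log, PowerSeries.coeff_mk, Nat.log_pow (one_lt_q p), if_pos rfl]

theorem coeff_log_ne {n : ℕ} (h : PowerSeries.coeff n (log p) ≠ 0) :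
    ∃ k, n = (p ^ 2) ^ k := by
  rw [log, PowerSeries.coeff_mk] at h
  by_contra h'
  push Not at h'
  exact h (if_neg (h' _))

theorem coeff_log_zero : PowerSeries.coeff 0 (log p) = 0 := by
  by_contra h
  obtain ⟨k, hk⟩ := coeff_log_ne p h
  exact (pow_pos (lt_trans Nat.zero_lt_one (one_lt_q p)) k).ne hk

theorem constantCoeff_log : PowerSeries.constantCoeff (log p) = 0 := by
  rw [← PowerSeries.coeff_zero_eq_constantCoeff_apply, coeff_log_zero]

theorem coeff_log_one : PowerSeries.coeff 1 (log p) = 1 := by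
  simpa using coeff_log_pow p 0

instance : Invertible (PowerSeries.coeff 1 (log p)) :=
  ⟨1, by rw [coeff_log_one, one_mul], by rw [coeff_log_one, one_mul]⟩

theorem coeff_log_mul {n : ℕ} (hn : n ≠ 0) :
    PowerSeries.coeff (p ^ 2 * n) (log p) = (p : ℚ_[p])⁻¹ * PowerSeries.coeff n (log p) := by
  by_cases h : ∃ k, n = (p ^ 2) ^ k
  · obtain ⟨k, rfl⟩ := h
    rw [← pow_succ', coeff_log_pow, coeff_log_pow, pow_succ', mul_inv]
  · have h1 : PowerSeries.coeff n (log p) = 0 := by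
      by_contra h'; exact h (coeff_log_ne p h')
    have h2 : PowerSeries.coeff (p ^ 2 * n) (log p) = 0 := by
      by_contra h'
      obtain ⟨k, hk⟩ := coeff_log_ne p h'
      have hp0 : 0 < p ^ 2 := lt_trans Nat.zero_lt_one (one_lt_q p)
      cases k with
      | zero =>
        rw [pow_zero] at hk
        have := Nat.eq_one_of_mul_eq_one_right hk
        have := one_lt_q p
        omega
      | succ k =>
        rw [pow_succ' (p ^ 2)] at hk
        exact h ⟨k, Nat.eq_of_mul_eq_mul_left hp0 hk⟩
    rw [h1, h2, mul_zero]

theorem coeff_log_subst {σ : Type*} {A : MvPowerSeries σ ℚ_[p]} (hA : A.constantCoeff = 0)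
    {d : σ →₀ ℕ} {N : ℕ} (hN : d.degree < N) :
    ((log p).subst A).coeff d =
      ∑ k ∈ Finset.range N, ((p : ℚ_[p]) ^ k)⁻¹ * (A ^ (p ^ 2) ^ k).coeff d := by
  classical
  have hinj : Set.InjOn (fun k => (p ^ 2) ^ k) (Finset.range N : Set ℕ) :=
    (Nat.pow_right_injective (one_lt_q p)).injOn
  rw [PowerSeries.coeff_subst (PowerSeries.HasSubst.of_constantCoeff_zero hA),
    finsum_eq_sum_of_support_subset (s := (Finset.range N).image fun k => (p ^ 2) ^ k),
    Finset.sum_image hinj]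
  · refine Finset.sum_congr rfl fun k _ => ?_
    rw [coeff_log_pow, smul_eq_mul]
  · intro n hn
    rw [Function.mem_support, smul_eq_mul] at hn
    obtain ⟨k, rfl⟩ := coeff_log_ne p (left_ne_zero_of_mul hn)
    have hk : k < N := by
      by_contra h
      have h1 : k < (p ^ 2) ^ k := Nat.lt_pow_self (one_lt_q p)
      exact right_ne_zero_of_mul hn (coeff_pow_eq_zero hA (by omega))
    simp only [Finset.coe_image, Finset.coe_range]
    exact ⟨k, hk, rfl⟩

/-- The formal group law over `ℚ_[p]` with logarithm `log p`, as a power series. -/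
def rationalSeries : MvPowerSeries (Fin 2) ℚ_[p] :=
  (log p).substInv.subst
    ((log p).subst (X 0 : MvPowerSeries (Fin 2) ℚ_[p]) + (log p).subst (X 1))

theorem hasSubst_log_add : PowerSeries.HasSubst
    ((log p).subst (X 0 : MvPowerSeries (Fin 2) ℚ_[p]) + (log p).subst (X 1)) := by
  have h : ∀ s : Fin 2, PowerSeries.HasSubst
      ((log p).subst (X s : MvPowerSeries (Fin 2) ℚ_[p])) := fun s =>
    PowerSeries.HasSubst.of_constantCoeff_zero
      (PowerSeries.constantCoeff_subst_eq_zero (constantCoeff_X s) _ (constantCoeff_log p))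
  exact (h 0).add (h 1)

theorem constantCoeff_rationalSeries : (rationalSeries p).constantCoeff = 0 := by
  refine PowerSeries.constantCoeff_subst_eq_zero ?_ _ (PowerSeries.constantCoeff_substInv _)
  rw [map_add, PowerSeries.constantCoeff_subst_eq_zero (constantCoeff_X 0) _ (constantCoeff_log p),
    PowerSeries.constantCoeff_subst_eq_zero (constantCoeff_X 1) _ (constantCoeff_log p), add_zero]

theorem log_rationalSeries : (log p).subst (rationalSeries p) =
    (log p).subst (X 0 : MvPowerSeries (Fin 2) ℚ_[p]) + (log p).subst (X 1) := by
  have h := PowerSeries.subst_comp_subst_apply (PowerSeries.HasSubst.substInv (log p))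
    (hasSubst_log_add p) (log p)
  rw [rationalSeries, ← h, PowerSeries.subst_substInv_right _ (constantCoeff_log p),
    PowerSeries.subst_X (hasSubst_log_add p)]

theorem log_subst_inj {σ : Type*} {a b : MvPowerSeries σ ℚ_[p]} (ha : PowerSeries.HasSubst a)
    (hb : PowerSeries.HasSubst b) (h : (log p).subst a = (log p).subst b) : a = b := by
  have hl : PowerSeries.HasSubst (log p) :=
    PowerSeries.HasSubst.of_constantCoeff_zero' (constantCoeff_log p)
  have key : ∀ {c : MvPowerSeries σ ℚ_[p]}, PowerSeries.HasSubst c →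
      (log p).substInv.subst ((log p).subst c) = c := fun {c} hc => by
    rw [← PowerSeries.subst_comp_subst_apply hl hc,
      PowerSeries.subst_substInv_left _ (constantCoeff_log p), PowerSeries.subst_X hc]
  rw [← key ha, h, key hb]

theorem log_rationalSeries_subst {σ : Type*} {a b : MvPowerSeries σ ℚ_[p]}
    (ha : PowerSeries.HasSubst a) (hb : PowerSeries.HasSubst b) :
    (log p).subst ((rationalSeries p).subst ![a, b]) = (log p).subst a + (log p).subst b := by
  have hab := FormalGroup.hasSubst_pair ha hb
  have h := congrArg (MvPowerSeries.subst ![a, b]) (log_rationalSeries p)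
  have key : ∀ {c : MvPowerSeries (Fin 2) ℚ_[p]}, PowerSeries.HasSubst c →
      ((log p).subst c).subst ![a, b] = (log p).subst (c.subst ![a, b]) := fun hc =>
    subst_comp_subst_apply hc.const hab (log p)
  rw [subst_add hab, key (PowerSeries.HasSubst.X 0), key (PowerSeries.HasSubst.X 1), subst_X hab,
    subst_X hab, key (PowerSeries.HasSubst.of_constantCoeff_zero
      (constantCoeff_rationalSeries p))] at h
  exact h

theorem coeff_log_single {s : Fin 2} {d : Fin 2 →₀ ℕ} :
    ((log p).subst (X s : MvPowerSeries (Fin 2) ℚ_[p])).coeff d =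
      if d = single s (d s) then PowerSeries.coeff (d s) (log p) else 0 :=
  PowerSeries.coeff_subst_single s (log p) d

/-- The recursion for the coefficients of the formal group law. -/
theorem coeff_rationalSeries {d : Fin 2 →₀ ℕ} {N : ℕ} (hN : d.degree < N + 1) :
    (rationalSeries p).coeff d =
      (((log p).subst (X 0 : MvPowerSeries (Fin 2) ℚ_[p]) + (log p).subst (X 1)).coeff d) -
      ∑ k ∈ Finset.range N,
        ((p : ℚ_[p]) ^ (k + 1))⁻¹ * (rationalSeries p ^ (p ^ 2) ^ (k + 1)).coeff d := by
  rw [← log_rationalSeries, coeff_log_subst p (constantCoeff_rationalSeries p) hN,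
    Finset.sum_range_succ']
  simp

theorem two_le_pow (k : ℕ) : 2 ≤ (p ^ 2) ^ (k + 1) :=
  Nat.one_lt_pow k.succ_ne_zero (one_lt_q p)

theorem pow_modEq_one (k : ℕ) : (p ^ 2) ^ k ≡ 1 [MOD p ^ 2 - 1] := by
  have h : p ^ 2 ≡ 1 [MOD p ^ 2 - 1] :=
    ((Nat.modEq_iff_dvd' (one_lt_q p).le).2 dvd_rfl).symm
  simpa using h.pow k

/-- Only monomials of degree `1` modulo `p ^ 2 - 1` occur in the formal group law. -/
theorem degree_modEq_one (d : Fin 2 →₀ ℕ) (hd : (rationalSeries p).coeff d ≠ 0) :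
    d.degree ≡ 1 [MOD p ^ 2 - 1] := by
  induction hn : d.degree using Nat.strong_induction_on generalizing d with
  | _ n ih =>
    subst hn
    by_contra hcon
    have hlog : ∀ s : Fin 2, ((log p).subst (X s : MvPowerSeries (Fin 2) ℚ_[p])).coeff d = 0 := by
      intro s
      by_contra h
      rw [coeff_log_single] at h
      by_cases hs : d = single s (d s)
      · rw [if_pos hs] at h
        obtain ⟨k, hk⟩ := coeff_log_ne p h
        apply hcon
        rw [hs, Finsupp.degree_single, hk]
        exact pow_modEq_one p k
      · exact h (if_neg hs)
    rw [coeff_rationalSeries p (N := d.degree) (Nat.lt_succ_self _), map_add, hlog, hlog] at hd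
    apply hd
    rw [Finset.sum_eq_zero, add_zero, sub_zero]
    intro k _
    rw [mul_eq_zero]
    right
    by_contra h
    exact hcon ((coeff_pow_modEq (constantCoeff_rationalSeries p)
      (fun e he hne => ih _ he e hne rfl) (two_le_pow p k) le_rfl h).trans (pow_modEq_one p (k + 1)))

/-- Modulo `p`, raising a power series over `ℤ_[p]` to the power `p ^ 2` raises the variables to
that power. -/
theorem dvd_expand_sub (H : MvPowerSeries (Fin 2) ℤ_[p]) :
    (p : MvPowerSeries (Fin 2) ℤ_[p]) ∣
      expand (p ^ 2) (ne_zero_of_lt (one_lt_q p)) H - H ^ p ^ 2 := by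
  have hp : p ≠ 0 := (Fact.out (p := p.Prime)).ne_zero
  have h : ∀ e, (p : ℤ_[p]) ∣
      (expand (p ^ 2) (ne_zero_of_lt (one_lt_q p)) H - H ^ p ^ 2).coeff e := by
    intro e
    rw [← Ideal.mem_span_singleton, ← PadicInt.maximalIdeal_eq_span_p, ← PadicInt.ker_toZMod,
      RingHom.mem_ker, ← coeff_map, map_sub, map_pow, map_expand,
      ← map_iterateFrobenius_expand p hp _ 2]
    have : iterateFrobenius (ZMod p) p 2 = RingHom.id (ZMod p) := by
      ext x
      simp [iterateFrobenius_def, pow_two, pow_mul, ZMod.pow_card]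
    rw [this, map_id]
    simp
  choose c hc using h
  let c' : MvPowerSeries (Fin 2) ℤ_[p] := fun e => c e
  have hc' : ∀ e, c'.coeff e = c e := fun _ => rfl
  refine ⟨c', ?_⟩
  ext e
  rw [hc, ← map_natCast (C (σ := Fin 2) (R := ℤ_[p])), coeff_C_mul, hc']

theorem coeff_log_add_smul {d : Fin 2 →₀ ℕ} (hd : d ≠ 0) :
    ((log p).subst (X 0 : MvPowerSeries (Fin 2) ℚ_[p]) + (log p).subst (X 1)).coeff
        (p ^ 2 • d) =
      (p : ℚ_[p])⁻¹ *
        ((log p).subst (X 0 : MvPowerSeries (Fin 2) ℚ_[p]) + (log p).subst (X 1)).coeff d := by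
  have hp0 : p ≠ 0 := (Fact.out (p := p.Prime)).ne_zero
  have key : ∀ s : Fin 2,
      ((log p).subst (X s : MvPowerSeries (Fin 2) ℚ_[p])).coeff (p ^ 2 • d) =
      (p : ℚ_[p])⁻¹ * ((log p).subst (X s : MvPowerSeries (Fin 2) ℚ_[p])).coeff d := by
    intro s
    rw [coeff_log_single, coeff_log_single]
    have hiff : p ^ 2 • d = single s ((p ^ 2 • d) s) ↔ d = single s (d s) := by
      constructor
      · intro h
        ext t
        have := DFunLike.congr_fun h t
        simp only [Finsupp.smul_apply, smul_eq_mul, Finsupp.single_apply] at this ⊢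
        by_cases hst : s = t
        · simp [hst]
        · simpa [hst, hp0] using this
      · intro h
        ext t
        have := DFunLike.congr_fun h t
        simp only [Finsupp.smul_apply, smul_eq_mul, Finsupp.single_apply] at this ⊢
        by_cases hst : s = t
        · simp [hst]
        · simpa [hst, hp0] using this
    by_cases h : d = single s (d s)
    · rw [if_pos (hiff.2 h), if_pos h]
      have hs : d s ≠ 0 := fun h0 => hd (by rw [h, h0, single_zero])
      exact coeff_log_mul p hs
    · rw [if_neg (fun h' => h (hiff.1 h')), if_neg h, mul_zero]
  rw [map_add, map_add, key, key, mul_add]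

theorem integral_log {d : Fin 2 →₀ ℕ} {i : Fin 2} (hi : ¬ p ^ 2 ∣ d i) :
    ∃ z : ℤ_[p], algebraMap ℤ_[p] ℚ_[p] z =
      ((log p).subst (X 0 : MvPowerSeries (Fin 2) ℚ_[p]) + (log p).subst (X 1)).coeff d := by
  have key : ∀ s : Fin 2, ∃ z : ℤ_[p], algebraMap ℤ_[p] ℚ_[p] z =
      ((log p).subst (X s : MvPowerSeries (Fin 2) ℚ_[p])).coeff d := by
    intro s
    rw [coeff_log_single]
    by_cases h : d = single s (d s)
    · rw [if_pos h]
      by_cases h0 : PowerSeries.coeff (d s) (log p) = 0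
      · exact ⟨0, by rw [h0, map_zero]⟩
      · obtain ⟨k, hk⟩ := coeff_log_ne p h0
        cases k with
        | zero => exact ⟨1, by rw [hk, pow_zero, coeff_log_one, map_one]⟩
        | succ k =>
          exfalso
          apply hi
          rw [h, Finsupp.single_apply]
          split_ifs
          · rw [hk, pow_succ' (p ^ 2)]; exact dvd_mul_right _ _
          · exact dvd_zero _
    · exact ⟨0, by rw [if_neg h, map_zero]⟩
  obtain ⟨z0, h0⟩ := key 0
  obtain ⟨z1, h1⟩ := key 1
  exact ⟨z0 + z1, by rw [map_add, map_add, h0, h1]⟩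

/-- The formal group law with logarithm `log p` has `p`-adically integral coefficients. -/
theorem integral (d : Fin 2 →₀ ℕ) :
    ∃ z : ℤ_[p], algebraMap ℤ_[p] ℚ_[p] z = (rationalSeries p).coeff d := by
  classical
  induction hn : d.degree using Nat.strong_induction_on generalizing d with
  | _ n ih =>
    subst hn
    have hG := constantCoeff_rationalSeries p
    have hq := ne_zero_of_lt (one_lt_q p)
    have hp : (p : ℚ_[p]) ≠ 0 := by exact_mod_cast (Fact.out (p := p.Prime)).ne_zero
    have hz : ∀ e : Fin 2 →₀ ℕ, ∃ z : ℤ_[p], e.degree < d.degree →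
        algebraMap ℤ_[p] ℚ_[p] z = (rationalSeries p).coeff e := by
      intro e
      by_cases he : e.degree < d.degree
      · obtain ⟨z, h⟩ := ih _ he e rfl
        exact ⟨z, fun _ => h⟩
      · exact ⟨0, fun h => absurd h he⟩
    choose z hz using hz
    by_cases hd0 : d = 0
    · exact ⟨0, by rw [hd0, map_zero, coeff_zero_eq_constantCoeff_apply, hG]⟩
    let H0 : MvPowerSeries (Fin 2) ℤ_[p] := fun e => if e.degree < d.degree then z e else 0
    have hH0 : ∀ e, H0.coeff e = if e.degree < d.degree then z e else 0 := fun _ => rfl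
    let H := map (algebraMap ℤ_[p] ℚ_[p]) H0
    have hH : ∀ e : Fin 2 →₀ ℕ, e.degree < d.degree →
        (rationalSeries p).coeff e = H.coeff e := by
      intro e he
      rw [coeff_map, hH0, if_pos he, hz e he]
    have hdpos : 0 < d.degree := by
      rw [Nat.pos_iff_ne_zero, Ne, Finsupp.degree_eq_zero_iff]; exact hd0
    have hHc : H.constantCoeff = 0 := by
      rw [← coeff_zero_eq_constantCoeff_apply, ← hH 0 (by simpa using hdpos),
        coeff_zero_eq_constantCoeff_apply, hG]
    have hdvd : ∀ k : ℕ, ∃ c : ℤ_[p],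
        (expand (p ^ 2) hq H ^ (p ^ 2) ^ k).coeff d - (H ^ (p ^ 2) ^ (k + 1)).coeff d =
          (p : ℚ_[p]) ^ (k + 1) * algebraMap ℤ_[p] ℚ_[p] c := by
      intro k
      have h1 : (p : MvPowerSeries (Fin 2) ℤ_[p]) ^ (k + 1) ∣
          expand (p ^ 2) hq H0 ^ (p ^ 2) ^ k - (H0 ^ p ^ 2) ^ (p ^ 2) ^ k := by
        have h2 := dvd_sub_pow_of_dvd_sub (dvd_expand_sub p H0) (2 * k)
        rw [pow_mul p 2 k] at h2
        exact (pow_dvd_pow _ (by omega)).trans h2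
      obtain ⟨c, hc⟩ := h1
      refine ⟨c.coeff d, ?_⟩
      have h3 := congrArg (fun f => (map (algebraMap ℤ_[p] ℚ_[p]) f).coeff d) hc
      simp only [map_sub, map_mul, map_pow, map_natCast, map_expand] at h3
      rw [pow_succ' (p ^ 2) k, pow_mul H]
      rw [← map_natCast (C (σ := Fin 2) (R := ℚ_[p])), ← map_pow (C (σ := Fin 2) (R := ℚ_[p])),
        coeff_C_mul, coeff_map, ← map_pow] at h3
      rw [← map_pow]
      exact h3
    choose c hc using hdvd
    have hexp : ∀ k : ℕ, expand (p ^ 2) hq H ^ (p ^ 2) ^ k =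
        expand (p ^ 2) hq (H ^ (p ^ 2) ^ k) := fun k => (map_pow _ _ _).symm
    have hmain : (rationalSeries p).coeff d =
        ((((log p).subst (X 0 : MvPowerSeries (Fin 2) ℚ_[p]) + (log p).subst (X 1)).coeff d) -
          ∑ k ∈ Finset.range d.degree, ((p : ℚ_[p]) ^ (k + 1))⁻¹ *
            (expand (p ^ 2) hq (H ^ (p ^ 2) ^ k)).coeff d) +
        algebraMap ℤ_[p] ℚ_[p] (∑ k ∈ Finset.range d.degree, c k) := by
      rw [coeff_rationalSeries p (N := d.degree) (Nat.lt_succ_self _), map_sum, sub_add,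
        ← Finset.sum_sub_distrib]
      congr 1
      refine Finset.sum_congr rfl fun k _ => ?_
      rw [coeff_pow_congr hG hHc hH (two_le_pow p k) le_rfl, ← hexp]
      have h := hc k
      have hpk : (p : ℚ_[p]) ^ (k + 1) ≠ 0 := pow_ne_zero _ hp
      field_simp
      linear_combination -h
    suffices hb : ∃ w : ℤ_[p], algebraMap ℤ_[p] ℚ_[p] w =
        (((log p).subst (X 0 : MvPowerSeries (Fin 2) ℚ_[p]) + (log p).subst (X 1)).coeff d) -
          ∑ k ∈ Finset.range d.degree, ((p : ℚ_[p]) ^ (k + 1))⁻¹ *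
            (expand (p ^ 2) hq (H ^ (p ^ 2) ^ k)).coeff d by
      obtain ⟨w, hw⟩ := hb
      exact ⟨w + ∑ k ∈ Finset.range d.degree, c k, by rw [map_add, hw, hmain]⟩
    by_cases hdiv : ∀ i, p ^ 2 ∣ d i
    · obtain ⟨d', rfl⟩ : ∃ d' : Fin 2 →₀ ℕ, d = p ^ 2 • d' :=
        ⟨d.mapRange (· / p ^ 2) (Nat.zero_div _), by
          ext i
          simpa using (Nat.mul_div_cancel' (hdiv i)).symm⟩
      have hd' : d' ≠ 0 := fun h => hd0 (by rw [h, smul_zero])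
      have hdeg : (p ^ 2 • d').degree = p ^ 2 * d'.degree := by
        rw [map_nsmul, smul_eq_mul]
      have hdpos' : 0 < d'.degree := by
        rw [Nat.pos_iff_ne_zero, Ne, Finsupp.degree_eq_zero_iff]; exact hd'
      have hlt : d'.degree < (p ^ 2 • d').degree := by
        rw [hdeg]
        exact lt_mul_of_one_lt_left hdpos' (one_lt_q p)
      refine ⟨0, ?_⟩
      rw [map_zero, eq_comm, sub_eq_zero, coeff_log_add_smul p hd', ← log_rationalSeries,
        coeff_log_subst p hG hlt, Finset.mul_sum]
      refine Finset.sum_congr rfl fun k _ => ?_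
      rw [coeff_expand_smul, pow_succ' (p : ℚ_[p]), mul_inv, mul_assoc]
      congr 2
      cases k with
      | zero => simpa using hH d' hlt
      | succ k => exact coeff_pow_congr hG hHc hH (two_le_pow p k) hlt.le
    · push Not at hdiv
      obtain ⟨i, hi⟩ := hdiv
      obtain ⟨w, hw⟩ := integral_log p hi
      refine ⟨w, ?_⟩
      rw [Finset.sum_eq_zero, sub_zero, hw]
      intro k _
      rw [coeff_expand_of_not_dvd _ hq _ hi, mul_zero]

/-- The power series over `ℤ_[p]` of the formal group law with logarithm `log p`. -/
def integralSeries : MvPowerSeries (Fin 2) ℤ_[p] := fun d => (integral p d).choose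

theorem map_integralSeries : map (algebraMap ℤ_[p] ℚ_[p]) (integralSeries p) = rationalSeries p := by
  ext d
  exact (integral p d).choose_spec

theorem algebraMap_inj : Function.Injective (algebraMap ℤ_[p] ℚ_[p]) :=
  FaithfulSMul.algebraMap_injective _ _

theorem map_inj {σ : Type*} {a b : MvPowerSeries σ ℤ_[p]}
    (h : map (algebraMap ℤ_[p] ℚ_[p]) a = map (algebraMap ℤ_[p] ℚ_[p]) b) : a = b := by
  ext d
  apply algebraMap_inj p
  rw [← coeff_map, h, coeff_map]

theorem map_pair {σ : Type*} (a b : MvPowerSeries σ ℤ_[p]) :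
    (fun i => map (algebraMap ℤ_[p] ℚ_[p]) (![a, b] i)) =
      ![map (algebraMap ℤ_[p] ℚ_[p]) a, map (algebraMap ℤ_[p] ℚ_[p]) b] := by
  funext i
  fin_cases i <;> rfl

theorem map_integralSeries_subst {σ : Type*} {a b : MvPowerSeries σ ℤ_[p]}
    (ha : PowerSeries.HasSubst a) (hb : PowerSeries.HasSubst b) :
    map (algebraMap ℤ_[p] ℚ_[p]) ((integralSeries p).subst ![a, b]) =
      (rationalSeries p).subst
        ![map (algebraMap ℤ_[p] ℚ_[p]) a, map (algebraMap ℤ_[p] ℚ_[p]) b] := by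
  rw [map_subst (FormalGroup.hasSubst_pair ha hb), map_integralSeries, map_pair]

theorem constantCoeff_integralSeries : (integralSeries p).constantCoeff = 0 := by
  apply algebraMap_inj p
  rw [← constantCoeff_map, map_integralSeries, constantCoeff_rationalSeries, map_zero]

theorem coeff_integralSeries_single (s : Fin 2) : (integralSeries p).coeff (single s 1) = 1 := by
  apply algebraMap_inj p
  rw [← coeff_map, map_integralSeries, map_one,
    coeff_rationalSeries p (N := 1) (by rw [Finsupp.degree_single]; norm_num), map_add,
    coeff_log_single, coeff_log_single,
    Finset.sum_eq_zero fun k _ => by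
      rw [coeff_pow_eq_zero (constantCoeff_rationalSeries p) (by
        rw [Finsupp.degree_single]; exact two_le_pow p k), mul_zero]]
  fin_cases s <;> simp [coeff_log_one]

/-- The formal group law over `ℤ_[p]` with logarithm `log p`. -/
def integralLaw : FormalGroup ℤ_[p] where
  toPowerSeries := integralSeries p
  zero_constantCoeff := constantCoeff_integralSeries p
  lin_coeff_X := coeff_integralSeries_single p 0
  lin_coeff_Y := coeff_integralSeries_single p 1
  assoc := by
    have hX : ∀ (A : Type) [CommRing A] (s : Fin 3),
        PowerSeries.HasSubst (X s : MvPowerSeries (Fin 3) A) := fun A _ s =>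
      PowerSeries.HasSubst.X s
    have hsub : ∀ {a b : MvPowerSeries (Fin 3) ℤ_[p]}, PowerSeries.HasSubst a →
        PowerSeries.HasSubst b → PowerSeries.HasSubst ((integralSeries p).subst ![a, b]) :=
      fun ha hb => IsNilpotent_subst (FormalGroup.hasSubst_pair ha hb) (by
        rw [constantCoeff_integralSeries]; exact IsNilpotent.zero)
    have hsub' : ∀ {a b : MvPowerSeries (Fin 3) ℚ_[p]}, PowerSeries.HasSubst a →
        PowerSeries.HasSubst b → PowerSeries.HasSubst ((rationalSeries p).subst ![a, b]) :=
      fun ha hb => IsNilpotent_subst (FormalGroup.hasSubst_pair ha hb) (by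
        rw [constantCoeff_rationalSeries]; exact IsNilpotent.zero)
    apply map_inj p
    rw [map_integralSeries_subst p (hsub (hX _ 0) (hX _ 1)) (hX _ 2),
      map_integralSeries_subst p (hX _ 0) (hsub (hX _ 1) (hX _ 2)),
      map_integralSeries_subst p (hX _ 0) (hX _ 1), map_integralSeries_subst p (hX _ 1) (hX _ 2),
      map_X, map_X, map_X]
    apply log_subst_inj p (hsub' (hsub' (hX _ 0) (hX _ 1)) (hX _ 2))
      (hsub' (hX _ 0) (hsub' (hX _ 1) (hX _ 2)))
    rw [log_rationalSeries_subst p (hsub' (hX _ 0) (hX _ 1)) (hX _ 2),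
      log_rationalSeries_subst p (hX _ 0) (hX _ 1),
      log_rationalSeries_subst p (hX _ 0) (hsub' (hX _ 1) (hX _ 2)),
      log_rationalSeries_subst p (hX _ 1) (hX _ 2), add_assoc]

instance : (integralLaw p).IsComm where
  comm := by
    have hX : ∀ (A : Type) [CommRing A] (s : Fin 2),
        PowerSeries.HasSubst (X s : MvPowerSeries (Fin 2) A) := fun A _ s =>
      PowerSeries.HasSubst.X s
    change integralSeries p = (integralSeries p).subst ![X 1, X 0]
    apply map_inj p
    rw [map_integralSeries_subst p (hX _ 1) (hX _ 0), map_integralSeries, map_X, map_X]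
    apply log_subst_inj p
      (PowerSeries.HasSubst.of_constantCoeff_zero (constantCoeff_rationalSeries p))
    · exact IsNilpotent_subst (FormalGroup.hasSubst_pair (hX _ 1) (hX _ 0)) (by
        rw [constantCoeff_rationalSeries]; exact IsNilpotent.zero)
    · rw [log_rationalSeries_subst p (hX _ 1) (hX _ 0), log_rationalSeries, add_comm]

/-- The Honda formal group law of height 2 over `ZMod p`: the reduction modulo `p` of the formal
group law over `ℤ_[p]` with logarithm `log p`. -/
def law : FormalGroup (ZMod p) := (integralLaw p).map PadicInt.toZMod

end Honda

instance FormalGroup.isComm_map {R S : Type*} [CommRing R] [CommRing S] (F : FormalGroup R)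
    [F.IsComm] (f : R →+* S) : (F.map f).IsComm where
  comm := by
    change MvPowerSeries.map f F.toPowerSeries =
      (MvPowerSeries.map f F.toPowerSeries).subst ![MvPowerSeries.X 1, MvPowerSeries.X 0]
    conv_lhs => rw [FormalGroup.IsComm.comm (F := F)]
    rw [MvPowerSeries.map_subst MvPowerSeries.HasSubst.X_X]
    congr 1
    funext s
    fin_cases s <;> simp

/-! ### The Morava stabilizer group of height 2 -/

namespace Morava

open FormalGroup

variable (p : ℕ) [Fact p.Prime]

/-- The field with `p ^ 2` elements. -/
abbrev Fq : Type := GaloisField p 2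

instance : (Honda.law p).IsComm :=
  FormalGroup.isComm_map (Honda.integralLaw p) PadicInt.toZMod

/-- The Honda formal group law `Γ₂` of height 2, regarded over the field with `p ^ 2` elements. -/
def Gam : FormalGroup (Fq p) := (Honda.law p).map (algebraMap (ZMod p) (Fq p))

instance : (Gam p).IsComm :=
  FormalGroup.isComm_map (Honda.law p) (algebraMap (ZMod p) (Fq p))

/-- The endomorphism ring of `Γ₂` over the field with `p ^ 2` elements. -/
abbrev End : Type := (Gam p).Endo

/-- The group of automorphisms of `Γ₂` over the field with `p ^ 2` elements. -/
abbrev Aut : Type := (End p)ˣ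

theorem coeff_Gam_eq_zero {d : Fin 2 →₀ ℕ} (hd : ¬ d.degree ≡ 1 [MOD p ^ 2 - 1]) :
    (Gam p).toPowerSeries.coeff d = 0 := by
  have h : (Honda.integralSeries p).coeff d = 0 := by
    apply Honda.algebraMap_inj p
    rw [← MvPowerSeries.coeff_map, Honda.map_integralSeries, map_zero]
    by_contra h
    exact hd (Honda.degree_modEq_one p d h)
  change MvPowerSeries.coeff d (MvPowerSeries.map _ (MvPowerSeries.map _ (Honda.integralSeries p))) = 0
  rw [MvPowerSeries.coeff_map, MvPowerSeries.coeff_map, h, map_zero, map_zero]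

theorem pow_eq_self (a : Fq p) {n : ℕ} (hn : n ≡ 1 [MOD p ^ 2 - 1]) (hn0 : n ≠ 0) : a ^ n = a := by
  let _ : Fintype (Fq p) := Fintype.ofFinite _
  have hcard : Fintype.card (Fq p) = p ^ 2 := by
    rw [← Nat.card_eq_fintype_card, GaloisField.card p 2 two_ne_zero]
  by_cases ha : a = 0
  · rw [ha, zero_pow hn0]
  · obtain ⟨k, hk⟩ := (Nat.modEq_iff_dvd' (Nat.one_le_iff_ne_zero.2 hn0)).1 hn.symm
    have h1 : n = (p ^ 2 - 1) * k + 1 := by omega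
    rw [h1, pow_succ, pow_mul, ← hcard, FiniteField.pow_card_sub_one_eq_one a ha, one_pow, one_mul]

/-- The power series `a x`, for `a` in the field with `p ^ 2` elements, as an endomorphism
of `Γ₂`. -/
def scalar (a : Fq p) : End p where
  series := a • PowerSeries.X
  constantCoeff_series := by simp
  series_add := by
    have hs : ∀ {c : MvPowerSeries (Fin 2) (Fq p)}, PowerSeries.HasSubst c →
        (a • PowerSeries.X : PowerSeries (Fq p)).subst c = a • c := fun hc => by
      rw [PowerSeries.subst_smul hc, PowerSeries.subst_X hc]
    rw [hs Endo.hasSubst_F, hs (PowerSeries.HasSubst.X 0), hs (PowerSeries.HasSubst.X 1)]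
    have h := MvPowerSeries.rescale_eq_subst (fun _ : Fin 2 => a) (Gam p).toPowerSeries
    have h2 : (![a • MvPowerSeries.X 0, a • MvPowerSeries.X 1] :
        Fin 2 → MvPowerSeries (Fin 2) (Fq p)) = (fun _ : Fin 2 => a) • MvPowerSeries.X := by
      funext s
      fin_cases s <;> rfl
    rw [h2, ← h]
    ext d
    rw [MvPowerSeries.coeff_rescale, MvPowerSeries.coeff_smul]
    by_cases hd : d.degree ≡ 1 [MOD p ^ 2 - 1]
    · by_cases hd0 : d = 0
      · rw [hd0, MvPowerSeries.coeff_zero_eq_constantCoeff_apply, (Gam p).zero_constantCoeff]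
        simp
      · congr 1
        rw [Finsupp.prod, Finset.prod_pow_eq_pow_sum]
        exact (pow_eq_self p a hd fun h => hd0 ((Finsupp.degree_eq_zero_iff d).1 h)).symm
    · rw [coeff_Gam_eq_zero p hd, mul_zero, mul_zero]

theorem scalar_mul (a b : Fq p) : scalar p (a * b) = scalar p a * scalar p b := by
  refine Endo.ext ?_
  rw [Endo.series_mul]
  change (a * b) • PowerSeries.X = (a • PowerSeries.X : PowerSeries (Fq p)).subst
    (b • PowerSeries.X : PowerSeries (Fq p))
  have hb : PowerSeries.HasSubst (b • PowerSeries.X : PowerSeries (Fq p)) :=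
    (scalar p b).hasSubst
  rw [PowerSeries.subst_smul hb, PowerSeries.subst_X hb, mul_smul]

/-- The homomorphism `a ↦ a x` from the nonzero elements of the field with `p ^ 2` elements to the
automorphism group of `Γ₂`. -/
def scalarUnit : (Fq p)ˣ →* Aut p :=
  Units.map
    { toFun := scalar p
      map_one' := Endo.ext (one_smul _ _)
      map_mul' := scalar_mul p }

/-- The copy of the Witt vectors of the field with `p ^ 2` elements in the endomorphism ring: the
closed subring generated by the endomorphisms `a x`. It consists of the endomorphisms
`a₀ x +_Γ a₂ x ^ (p ^ 2) +_Γ a₄ x ^ (p ^ 4) +_Γ ⋯`. -/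
def witt : Subring (End p) :=
  (Subring.closure (Set.range (scalar p))).topologicalClosure

instance : CommRing (witt p) :=
  { (witt p).toRing with
    mul_comm := by
      have h : ∀ x ∈ Set.range (scalar p), ∀ y ∈ Set.range (scalar p), x * y = y * x := by
        rintro _ ⟨a, rfl⟩ _ ⟨b, rfl⟩
        rw [← scalar_mul, ← scalar_mul, mul_comm]
      have h' := Subring.isMulCommutative_closure h
      exact (Subring.commRingTopologicalClosure (Subring.closure (Set.range (scalar p)))
        fun x y => h'.is_comm.comm x y).mul_comm }

/-- The determinant of an automorphism `g`: the determinant of the linear map `f ↦ f g` on the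
endomorphism ring, regarded as a (left) module over the Witt vectors. -/
def det : Aut p →* witt p where
  toFun g := LinearMap.det (LinearMap.mulRight (witt p) (g : End p))
  map_one' := by
    rw [Units.val_one, LinearMap.mulRight_one, LinearMap.det_id]
  map_mul' g h := by
    rw [Units.val_mul, LinearMap.mulRight_mul, LinearMap.det_comp, mul_comm]

/-- The derivative at `0`, that is, the coefficient of `x`. -/
def derivAtZero : End p →* Fq p where
  toFun f := PowerSeries.coeff 1 f.series
  map_one' := by simp
  map_mul' f g := by
    obtain ⟨v, hv⟩ := PowerSeries.X_dvd_iff.2 g.constantCoeff_series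
    have hg := g.hasSubst
    rw [Endo.series_mul, PowerSeries.coeff_subst' hg, finsum_eq_single _ 1]
    · rw [pow_one, smul_eq_mul]
    · intro n hn
      rcases n with _ | _ | n
      · rw [PowerSeries.coeff_zero_eq_constantCoeff_apply, f.constantCoeff_series, zero_smul]
      · exact absurd rfl hn
      · have h2 : (PowerSeries.X ^ 2 : PowerSeries (Fq p)) ∣ g.series ^ (n + 1 + 1) := by
          rw [hv, mul_pow]
          exact (pow_dvd_pow _ (by omega)).mul_right _
        rw [PowerSeries.X_pow_dvd_iff.1 h2 1 (by norm_num), smul_zero]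

/-- The group `S₂` of strict automorphisms: the automorphisms `f` with `f'(0) = 1`. -/
def S2 : Subgroup (Aut p) := (Units.map (derivAtZero p)).ker

/-- The group `S₂¹` of strict automorphisms of determinant `1`. -/
def S21 : Subgroup (Aut p) := S2 p ⊓ (det p).ker

instance : (S21 p).Normal := by
  unfold S21 S2
  infer_instance

end Morava

/-! ### Continuous cohomology with trivial coefficients in low degrees

`G` is a topological group acting trivially on the discrete commutative ring `A`; continuous
cochains with values in `A` are locally constant functions. -/

namespace ContCohomology

variable (A G : Type*) [CommRing A] [Group G] [TopologicalSpace G] [IsTopologicalGroup G]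

variable {G} in
/-- The differential `(∂ φ)(g, h) = φ(h) - φ(g h) + φ(g)` from continuous `1`-cochains to continuous
`2`-cochains. -/
def d₁ : LocallyConstant G A →ₗ[A] LocallyConstant (G × G) A where
  toFun φ := φ.comap ⟨fun x => x.2, by fun_prop⟩ - φ.comap ⟨fun x => x.1 * x.2, by fun_prop⟩ +
    φ.comap ⟨fun x => x.1, by fun_prop⟩
  map_add' φ ψ := by
    ext x
    simp only [LocallyConstant.add_apply, LocallyConstant.sub_apply,
      LocallyConstant.coe_comap_apply]
    ring
  map_smul' a φ := by
    ext x
    simp only [LocallyConstant.add_apply, LocallyConstant.sub_apply, LocallyConstant.smul_apply,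
      LocallyConstant.coe_comap_apply, smul_eq_mul, RingHom.id_apply]
    ring

variable {G} in
/-- The differential `(∂ ψ)(g, h, k) = ψ(h, k) - ψ(g h, k) + ψ(g, h k) - ψ(g, h)` from continuous
`2`-cochains to continuous `3`-cochains. -/
def d₂ : LocallyConstant (G × G) A →ₗ[A] LocallyConstant (G × G × G) A where
  toFun ψ := ψ.comap ⟨fun x => (x.2.1, x.2.2), by fun_prop⟩ -
    ψ.comap ⟨fun x => (x.1 * x.2.1, x.2.2), by fun_prop⟩ +
    ψ.comap ⟨fun x => (x.1, x.2.1 * x.2.2), by fun_prop⟩ -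
    ψ.comap ⟨fun x => (x.1, x.2.1), by fun_prop⟩
  map_add' φ ψ := by
    ext x
    simp only [LocallyConstant.add_apply, LocallyConstant.sub_apply,
      LocallyConstant.coe_comap_apply]
    ring
  map_smul' a φ := by
    ext x
    simp only [LocallyConstant.add_apply, LocallyConstant.sub_apply, LocallyConstant.smul_apply,
      LocallyConstant.coe_comap_apply, smul_eq_mul, RingHom.id_apply]
    ring

variable {A} in
variable {G} in
theorem d₁_apply (φ : LocallyConstant G A) (g h : G) :
    d₁ A φ (g, h) = φ h - φ (g * h) + φ g := rfl

variable {A} in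
variable {G} in
theorem d₂_apply (ψ : LocallyConstant (G × G) A) (g h k : G) :
    d₂ A ψ (g, h, k) = ψ (h, k) - ψ (g * h, k) + ψ (g, h * k) - ψ (g, h) := rfl

/-- `H¹(G, A)`. As the action is trivial there are no nonzero `1`-coboundaries, and `H¹` is the
module of continuous `1`-cocycles, that is, of continuous homomorphisms from `G` to `A`. -/
abbrev H1 : Type _ := LinearMap.ker (d₁ A (G := G))

/-- The module of continuous `2`-cocycles. -/
abbrev Z2 : Type _ := LinearMap.ker (d₂ A (G := G))

/-- `H²(G, A)`: continuous `2`-cocycles modulo coboundaries of continuous `1`-cochains. -/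
abbrev H2 : Type _ :=
  Z2 A G ⧸ (LinearMap.range (d₁ A (G := G))).comap (LinearMap.ker (d₂ A (G := G))).subtype

variable {A G}

theorem H1.map_mul (φ : H1 A G) (g h : G) : φ.1 (g * h) = φ.1 g + φ.1 h := by
  have := LocallyConstant.congr_fun (LinearMap.mem_ker.1 φ.2) (g, h)
  rw [d₁_apply, LocallyConstant.zero_apply] at this
  linear_combination -this

/-- The cup product of two continuous `1`-cocycles: the `2`-cocycle `(g, h) ↦ φ(g) ψ(h)`. -/
def cupCochain (φ ψ : H1 A G) : Z2 A G :=
  ⟨φ.1.comap ⟨fun x : G × G => x.1, by fun_prop⟩ * ψ.1.comap ⟨fun x : G × G => x.2, by fun_prop⟩, by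
    rw [LinearMap.mem_ker]
    ext ⟨g, h, k⟩
    simp only [d₂_apply, LocallyConstant.mul_apply, LocallyConstant.coe_comap_apply,
      ContinuousMap.coe_mk, H1.map_mul, LocallyConstant.zero_apply]
    ring⟩

/-- The cup product `H¹(G, A) × H¹(G, A) → H²(G, A)`. -/
def cup (φ ψ : H1 A G) : H2 A G :=
  Submodule.Quotient.mk (cupCochain φ ψ)

/-- The map on `H¹` induced by a continuous homomorphism. -/
def H1.map {G' : Type*} [Group G'] [TopologicalSpace G'] [IsTopologicalGroup G'] (u : G →ₜ* G') :
    H1 A G' →ₗ[A] H1 A G where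
  toFun φ := ⟨φ.1.comap u, by
    rw [LinearMap.mem_ker]
    ext ⟨g, h⟩
    simp only [d₁_apply, LocallyConstant.coe_comap_apply, LocallyConstant.zero_apply]
    change φ.1 (u h) - φ.1 (u (g * h)) + φ.1 (u g) = 0
    rw [_root_.map_mul, H1.map_mul]
    ring⟩
  map_add' φ ψ := rfl
  map_smul' a φ := rfl

end ContCohomology

namespace Morava

open FormalGroup ContCohomology

variable (p : ℕ) [Fact p.Prime]

/-- Conjugation `f ↦ g⁻¹ f g` on the group `S₂¹`, for an automorphism `g`. -/
def conj (g : Aut p) : S21 p →ₜ* S21 p where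
  toMonoidHom := (MulAut.conjNormal g⁻¹ : S21 p ≃* S21 p)
  continuous_toFun := by
    refine Continuous.subtype_mk (?_ : Continuous fun f : S21 p => g⁻¹ * (f : Aut p) * g⁻¹⁻¹) _
    fun_prop

theorem conj_apply (g : Aut p) (f : S21 p) :
    ((conj p g f : S21 p) : Aut p) = g⁻¹ * (f : Aut p) * g := by
  change g⁻¹ * (f : Aut p) * g⁻¹⁻¹ = _
  rw [inv_inv]

/-- The action of the nonzero elements `a` of the field with `p ^ 2` elements on `H¹(S₂¹)`: it sends
the cocycle `φ` to `f ↦ φ(a⁻¹ f(a x))`. -/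
def H1Rep : Representation (Fq p) (Fq p)ˣ (H1 (Fq p) (S21 p)) where
  toFun a := H1.map (conj p (scalarUnit p a))
  map_one' := by
    ext φ f
    change φ.1 (conj p (scalarUnit p 1) f) = φ.1 f
    congr 1
    exact Subtype.ext (by simp [conj_apply])
  map_mul' a b := by
    ext φ f
    change φ.1 (conj p (scalarUnit p (a * b)) f) =
      φ.1 (conj p (scalarUnit p b) (conj p (scalarUnit p a) f))
    congr 1
    exact Subtype.ext (by simp [conj_apply, mul_assoc])

/-- The one-dimensional representation `𝔽(t)`, in which `a` acts as multiplication by `a ^ t`. -/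
def twist (t : ℕ) : Representation (Fq p) (Fq p)ˣ (Fq p) where
  toFun a := ((a : Fq p) ^ t) • LinearMap.id
  map_one' := by simp; rfl
  map_mul' a b := by
    ext
    simp [mul_pow, mul_comm]

end Morava

end

/-!
The endomorphism ring `𝒪` of `Γ₂` is studied through the Frobenius `S = x ^ p`. Differentiating
`f(x +_Γ y) = f(x) +_Γ f(y)` at `y = 0` shows that an endomorphism with `f'(0) = 0` is a power series
in `x ^ p` (`exists_eq_mul_frob`), so reduction modulo `S` is `f ↦ f'(0)`, the powers of `S` generate
two-sided ideals `J n` with intersection `0`, and every `f` has a unique expansion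
`a₀ + a₁ S + a₂ S² + ⋯` in which the `aᵢ` stand for the endomorphisms `aᵢ x`
(`isExpansion_digit`, `digit_eq_of_isExpansion`). These satisfy `S a = aᵖ S` and are additive modulo
`S²`: the defect commutes with every `ω x`, so it cannot have a term of degree one in `S`. Expanding
a product modulo `S³` gives the cocycle condition for `τ₁`, `τ₂` and the formula `∂σ = -τ₁τ₂`.

The determinant is computed from an explicit basis. The coefficient of `x ^ (p ^ 2)` in `[p](x)` can
be read off from the logarithm, and shows that `p` is `S²` up to a unit (`exists_natCast_eq`). It
follows that the Witt vectors `W` are the centralizer of `ω x`, for any `ω` outside the prime field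
(`mem_witt_iff`), and that `𝒪` is free over `W` on `1` and `S`, the two summands being given by
`ω f = f ω` and `ω f = f ωᵖ`. Hence `det(α + β S) = α ᾱ - β̄ S² β` (`det_mulRight`), where the bar is
conjugation by `S`, and an element `1 + r S ^ (2 k)` of `S₂¹`, with `k ≥ 1`, satisfies
`r₀ᵖ = -r₀` for `r₀ = r'(0)` (`pow_eq_neg_of_mem_S21`).

The main point is that a continuous homomorphism `φ` from `S₂¹` to the field depends only on `a₁`.
Commutators of automorphisms lie in `S₂¹`, and provide elements with every leading coefficient in
odd degree, and with every leading coefficient of trace zero in degree two. Commutators of these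
elements in turn realize every leading coefficient that the determinant allows in degrees at least
two (`exists_commutator_sub_mem_J`). So an element of `S₂¹` congruent to `1` modulo `S²` is a product
of commutators and of an element arbitrarily close to `1`, and `φ` vanishes on it
(`H1_eq_zero_of_mem_J_two`). Therefore `φ` is an additive function of `a₁`, and the additive maps of
the field with `p ^ 2` elements are the combinations of `a` and `a ^ p`.
-/

noncomputable section

/-! ### Endomorphisms of a formal group law -/

namespace FormalGroup

variable {R : Type*} [CommRing R]

theorem exists_toPowerSeries_eq (F : FormalGroup R) : ∃ G : MvPowerSeries (Fin 2) R,
    F.toPowerSeries = MvPowerSeries.X 0 + MvPowerSeries.X 1 * G ∧ G.constantCoeff = 1 := by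
  have h0 : (MvPowerSeries.X 1 : MvPowerSeries (Fin 2) R) ∣
      F.toPowerSeries - MvPowerSeries.X 0 := by
    rw [MvPowerSeries.X_dvd_iff]
    intro m hm
    obtain ⟨n, rfl⟩ : ∃ n, m = Finsupp.single 0 n :=
      ⟨m 0, by ext s; fin_cases s <;> simp [hm]⟩
    rw [map_sub, F.coeff_single_zero, MvPowerSeries.coeff_X]
    by_cases hn : n = 1 <;> simp [hn, Finsupp.single_eq_single_iff]
  obtain ⟨G, hG⟩ := h0
  refine ⟨G, by rw [← hG]; ring, ?_⟩
  have h := congrArg (MvPowerSeries.coeff (Finsupp.single 1 1)) hG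
  rw [map_sub, F.lin_coeff_Y, MvPowerSeries.coeff_X,
    if_neg (by simp [Finsupp.single_eq_single_iff]), sub_zero, mul_comm,
    ← _root_.zero_add (Finsupp.single 1 1), MvPowerSeries.X,
    MvPowerSeries.coeff_add_mul_monomial, mul_one] at h
  simpa using h.symm

theorem coeff_X_zero_pow_mul_X_one_mul (G : MvPowerSeries (Fin 2) R) (n m : ℕ) (h : n ≤ m) :
    MvPowerSeries.coeff (Finsupp.single 0 n + Finsupp.single 1 1)
      (MvPowerSeries.X 0 ^ m * MvPowerSeries.X 1 * G) =
        if m = n then G.constantCoeff else 0 := by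
  rw [MvPowerSeries.X_pow_eq, MvPowerSeries.X, MvPowerSeries.monomial_mul_monomial,
    MvPowerSeries.coeff_monomial_mul]
  by_cases hmn : m = n
  · subst hmn
    simp
  · rw [if_neg, if_neg hmn]
    intro hle
    have := hle 0
    simp at this
    omega

/-- Modulo `y ^ 2`, the power `F(x, y) ^ m` is `x ^ m + m x ^ (m - 1) y G(x, y)`. -/
theorem coeff_toPowerSeries_pow (F : FormalGroup R) {G : MvPowerSeries (Fin 2) R}
    (hG : F.toPowerSeries = MvPowerSeries.X 0 + MvPowerSeries.X 1 * G) (n m : ℕ) :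
    MvPowerSeries.coeff (Finsupp.single 0 n + Finsupp.single 1 1) (F.toPowerSeries ^ m) =
      m * MvPowerSeries.coeff (Finsupp.single 0 n + Finsupp.single 1 1)
        (MvPowerSeries.X 0 ^ (m - 1) * MvPowerSeries.X 1 * G) := by
  obtain ⟨k, hk⟩ := Polynomial.powAddExpansion (MvPowerSeries.X 0 : MvPowerSeries (Fin 2) R)
    (MvPowerSeries.X 1 * G) m
  have h1 : MvPowerSeries.coeff (Finsupp.single 0 n + Finsupp.single 1 1)
      (MvPowerSeries.X 0 ^ m : MvPowerSeries (Fin 2) R) = 0 := by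
    classical
    rw [MvPowerSeries.coeff_X_pow, if_neg]
    intro h
    have := DFunLike.congr_fun h 1
    simp at this
  have h2 : MvPowerSeries.coeff (Finsupp.single 0 n + Finsupp.single 1 1)
      (k * (MvPowerSeries.X 1 * G) ^ 2) = 0 := by
    rw [mul_pow]
    refine MvPowerSeries.X_pow_dvd_iff.1 ((dvd_mul_right _ _).mul_left _) _ ?_
    simp
  rw [hG, hk, map_add, map_add, h1, h2, _root_.zero_add, _root_.add_zero, mul_assoc, mul_assoc,
    ← map_natCast (MvPowerSeries.C (σ := Fin 2) (R := R)), MvPowerSeries.coeff_C_mul]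

namespace Endo

variable {F : FormalGroup R}

/-- If `f'(0) = 0`, then the derivative of `f` vanishes: compare the coefficients of
`x ^ (n - 1) y` in `f(x +_F y) = f(x) +_F f(y)`. -/
theorem natCast_mul_coeff_eq_zero (f : F.Endo) (h1 : PowerSeries.coeff 1 f.series = 0) (n : ℕ) :
    (n : R) * PowerSeries.coeff n f.series = 0 := by
  classical
  induction n using Nat.strong_induction_on with
  | _ n ih =>
  rcases n with _ | _ | n
  · simp
  · simp [h1]
  obtain ⟨G, hG, hG1⟩ := F.exists_toPowerSeries_eq
  have h0 := PowerSeries.HasSubst.X (S := R) (0 : Fin 2)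
  have h1' := PowerSeries.HasSubst.X (S := R) (1 : Fin 2)
  have hab := hasSubst_pair (hasSubst_subst f.constantCoeff_series h0)
    (hasSubst_subst f.constantCoeff_series h1')
  have key := congrArg (MvPowerSeries.coeff (Finsupp.single 0 (n + 1) + Finsupp.single 1 1))
    f.series_add
  -- `f(y)` is divisible by `y ^ 2`, so the right-hand side has no term `x ^ (n - 1) y`
  obtain ⟨v, hv⟩ : PowerSeries.X ^ 2 ∣ f.series := by
    rw [PowerSeries.X_pow_dvd_iff]
    intro m hm
    interval_cases m
    · simpa using f.constantCoeff_series
    · exact h1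
  have hdvd : (MvPowerSeries.X 1 : MvPowerSeries (Fin 2) R) ^ 2 ∣
      f.series.subst (MvPowerSeries.X 1 : MvPowerSeries (Fin 2) R) := by
    rw [hv, PowerSeries.subst_mul h1', PowerSeries.subst_pow h1', PowerSeries.subst_X h1']
    exact dvd_mul_right _ _
  have hR : MvPowerSeries.coeff (Finsupp.single 0 (n + 1) + Finsupp.single 1 1)
      (F.toPowerSeries.subst
        ![f.series.subst (MvPowerSeries.X 0 : MvPowerSeries (Fin 2) R),
          f.series.subst (MvPowerSeries.X 1 : MvPowerSeries (Fin 2) R)]) = 0 := by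
    rw [hG, MvPowerSeries.subst_add hab, MvPowerSeries.subst_mul hab, MvPowerSeries.subst_X hab,
      MvPowerSeries.subst_X hab]
    simp only [Matrix.cons_val_zero, Matrix.cons_val_one, Matrix.cons_val_fin_one]
    rw [map_add, PowerSeries.coeff_subst_single, if_neg, _root_.zero_add]
    · refine MvPowerSeries.X_pow_dvd_iff.1 (hdvd.mul_right _) _ ?_
      simp
    · intro h
      have := DFunLike.congr_fun h 1
      simp at this
  rw [hR, PowerSeries.coeff_subst hasSubst_F, finsum_eq_single _ (n + 1 + 1)] at key
  · rw [coeff_toPowerSeries_pow F hG, Nat.add_sub_cancel,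
      coeff_X_zero_pow_mul_X_one_mul _ _ _ le_rfl, if_pos rfl, hG1, mul_one, smul_eq_mul,
      mul_comm] at key
    exact key
  · intro m hm
    rw [coeff_toPowerSeries_pow F hG, smul_eq_mul]
    -- lower coefficients of `f` are killed by induction, higher powers of `F` by their degree
    rcases lt_or_gt_of_ne hm with hm | hm
    · rw [← mul_assoc, mul_comm _ (m : R), ih m hm, zero_mul]
    · rw [coeff_X_zero_pow_mul_X_one_mul _ _ _ (by omega), if_neg (by omega), mul_zero, mul_zero]

theorem coeff_one_add [F.IsComm] (f g : F.Endo) : PowerSeries.coeff 1 (f + g).series =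
    PowerSeries.coeff 1 f.series + PowerSeries.coeff 1 g.series := by
  obtain ⟨H, hH⟩ := F.exists_eq_add_mul
  obtain ⟨u, hu⟩ := PowerSeries.X_dvd_iff.2 f.constantCoeff_series
  obtain ⟨v, hv⟩ := PowerSeries.X_dvd_iff.2 g.constantCoeff_series
  have h : (PowerSeries.X ^ 2 : PowerSeries R) ∣ f.series * g.series *
      (H.subst ![f.series, g.series] : PowerSeries R) := by
    refine Dvd.dvd.mul_right ?_ _
    rw [hu, hv, pow_two]
    exact mul_dvd_mul (dvd_mul_right _ _) (dvd_mul_right _ _)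
  rw [series_sum, hH f.constantCoeff_series g.constantCoeff_series, map_add, map_add,
    PowerSeries.X_pow_dvd_iff.1 h 1 (by norm_num), _root_.add_zero]

/-- An endomorphism whose derivative at `0` is invertible is an automorphism: the inverse power
series is again an endomorphism. -/
theorem isUnit_of_isUnit_coeff_one [F.IsComm] (f : F.Endo)
    (hf : IsUnit (PowerSeries.coeff 1 f.series)) : IsUnit f := by
  have hf0 := f.constantCoeff_series
  set g := f.series.substInvOfIsUnit hf with hg
  have hg0 : PowerSeries.constantCoeff g = 0 := PowerSeries.constantCoeff_substInvOfIsUnit _ hf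
  have hfg : f.series.subst g = PowerSeries.X := PowerSeries.subst_substInvOfIsUnit_right _ hf0 hf
  have hgf : g.subst f.series = PowerSeries.X := PowerSeries.subst_substInvOfIsUnit_left _ hf0 hf
  have hcomp : ∀ {a : MvPowerSeries (Fin 2) R}, PowerSeries.HasSubst a →
      f.series.subst (g.subst a) = a := fun ha => by
    rw [← comp_subst _ hg0 ha, hfg, PowerSeries.subst_X ha]
  have hcomp' : ∀ {a : MvPowerSeries (Fin 2) R}, PowerSeries.HasSubst a →
      g.subst (f.series.subst a) = a := fun ha => by
    rw [← comp_subst _ hf0 ha, hgf, PowerSeries.subst_X ha]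
  have h0 := PowerSeries.HasSubst.X (S := R) (0 : Fin 2)
  have h1 := PowerSeries.HasSubst.X (S := R) (1 : Fin 2)
  have hadd : PowerSeries.HasSubst (F.toPowerSeries.subst
      ![g.subst (MvPowerSeries.X 0 : MvPowerSeries (Fin 2) R),
        g.subst (MvPowerSeries.X 1 : MvPowerSeries (Fin 2) R)]) :=
    MvPowerSeries.IsNilpotent_subst (hasSubst_pair (hasSubst_subst hg0 h0) (hasSubst_subst hg0 h1))
      (by rw [F.zero_constantCoeff]; exact IsNilpotent.zero)
  let g' : F.Endo := ⟨g, hg0, by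
    rw [← hcomp' hadd, f.subst_add (hasSubst_subst hg0 h0) (hasSubst_subst hg0 h1), hcomp h0,
      hcomp h1]
    congr 2
    conv_lhs => rw [← id_eq F.toPowerSeries, ← MvPowerSeries.subst_self]
    congr 1
    funext s
    fin_cases s <;> rfl⟩
  exact ⟨⟨f, g', Endo.ext hfg, Endo.ext hgf⟩, rfl⟩

end Endo

end FormalGroup

/-! ### The Frobenius endomorphism and its powers -/

namespace Morava

open FormalGroup

variable (p : ℕ) [Fact p.Prime]

/-- As `Γ₂` is defined over the prime field, `Γ₂(x ^ p, y ^ p) = Γ₂(x, y) ^ p`. -/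
theorem expand_Gam : MvPowerSeries.expand p (Fact.out (p := p.Prime)).ne_zero
    (Gam p).toPowerSeries = (Gam p).toPowerSeries ^ p := by
  have hp := (Fact.out (p := p.Prime)).ne_zero
  have h := MvPowerSeries.map_frobenius_expand p hp (f := (Honda.law p).toPowerSeries)
  rw [ZMod.frobenius_zmod, MvPowerSeries.map_id, RingHom.id_apply] at h
  change MvPowerSeries.expand p hp (MvPowerSeries.map (algebraMap (ZMod p) (Fq p)) _) =
    (MvPowerSeries.map (algebraMap (ZMod p) (Fq p)) _) ^ p
  rw [← MvPowerSeries.map_expand, h, map_pow]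

/-- The Frobenius endomorphism `x ^ p` of `Γ₂`. -/
def frob : End p where
  series := PowerSeries.X ^ p
  constantCoeff_series := by simp [(Fact.out (p := p.Prime)).ne_zero]
  series_add := by
    have hX : ∀ s : Fin 2, PowerSeries.HasSubst (MvPowerSeries.X s : MvPowerSeries (Fin 2) (Fq p)) :=
      fun s => PowerSeries.HasSubst.X s
    rw [PowerSeries.subst_pow Endo.hasSubst_F, PowerSeries.subst_X Endo.hasSubst_F,
      PowerSeries.subst_pow (hX 0), PowerSeries.subst_X (hX 0), PowerSeries.subst_pow (hX 1),
      PowerSeries.subst_X (hX 1), ← expand_Gam, MvPowerSeries.expand, MvPowerSeries.substAlgHom_apply]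
    congr 1
    funext s
    fin_cases s <;> rfl

theorem coeff_mul_frob (f : End p) (n : ℕ) : PowerSeries.coeff n (f * frob p).series =
    if p ∣ n then PowerSeries.coeff (n / p) f.series else 0 := by
  rw [Endo.series_mul]
  exact PowerSeries.coeff_subst_X_pow (Fact.out (p := p.Prime)).ne_zero _ _

theorem mul_frob_injective : Function.Injective fun f : End p => f * frob p := by
  intro f g h
  have hp := (Fact.out (p := p.Prime)).pos
  refine Endo.ext (PowerSeries.ext fun n => ?_)
  have h' := congrArg (fun f : End p => PowerSeries.coeff (p * n) f.series) h
  simpa only [coeff_mul_frob, dvd_mul_right, if_true, Nat.mul_div_cancel_left _ hp] using h'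

theorem frob_mul_series (f : End p) : (frob p * f).series = f.series ^ p := by
  rw [Endo.series_mul, frob, PowerSeries.subst_pow f.hasSubst, PowerSeries.subst_X f.hasSubst]

/-- An endomorphism with vanishing derivative at `0` factors through the Frobenius. -/
theorem exists_eq_mul_frob (f : End p) (hf : derivAtZero p f = 0) : ∃ g : End p, f = g * frob p := by
  have hp := (Fact.out (p := p.Prime)).ne_zero
  let g : PowerSeries (Fq p) := PowerSeries.mk fun n => PowerSeries.coeff (p * n) f.series
  have hg0 : PowerSeries.constantCoeff g = 0 := by
    simp [g, ← PowerSeries.coeff_zero_eq_constantCoeff_apply, -PowerSeries.coeff_zero_eq_constantCoeff]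
    simpa using f.constantCoeff_series
  have hexp : f.series = PowerSeries.expand p hp g := by
    ext n
    rw [PowerSeries.coeff_expand]
    split_ifs with hn
    · simp [g, Nat.mul_div_cancel' hn]
    · have h := f.natCast_mul_coeff_eq_zero hf n
      refine (mul_eq_zero.1 h).resolve_left ?_
      rwa [CharP.cast_eq_zero_iff (Fq p) p]
  have hfg : f.series = g.subst (PowerSeries.X ^ p : PowerSeries (Fq p)) := by
    rw [hexp, PowerSeries.expand_apply]
  have hXp : PowerSeries.HasSubst (PowerSeries.X ^ p : PowerSeries (Fq p)) :=
    PowerSeries.HasSubst.X_pow hp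
  have hX : ∀ s : Fin 2, PowerSeries.HasSubst (MvPowerSeries.X s : MvPowerSeries (Fin 2) (Fq p)) :=
    fun s => PowerSeries.HasSubst.X s
  have key : ∀ {a : MvPowerSeries (Fin 2) (Fq p)}, PowerSeries.HasSubst a →
      f.series.subst a = g.subst (a ^ p) := fun ha => by
    rw [hfg, PowerSeries.subst_comp_subst_apply hXp ha, PowerSeries.subst_pow ha,
      PowerSeries.subst_X ha]
  have hexpX : ∀ s : Fin 2, MvPowerSeries.expand p hp (g.subst (MvPowerSeries.X s :
      MvPowerSeries (Fin 2) (Fq p))) = f.series.subst (MvPowerSeries.X s) := fun s => by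
    rw [PowerSeries.expand_subst p hp (hX s), MvPowerSeries.expand_X, key (hX s)]
  refine ⟨⟨g, hg0, ?_⟩, Endo.ext hfg⟩
  have hinj : Function.Injective (MvPowerSeries.expand (σ := Fin 2) (R := Fq p) p hp) := by
    intro a b h
    ext d
    rw [← MvPowerSeries.coeff_expand_smul p hp a, h, MvPowerSeries.coeff_expand_smul]
  apply hinj
  rw [PowerSeries.expand_subst p hp Endo.hasSubst_F, expand_Gam, ← key Endo.hasSubst_F,
    f.series_add, MvPowerSeries.expand_subst p hp
      (hasSubst_pair (hasSubst_subst hg0 (hX 0)) (hasSubst_subst hg0 (hX 1)))]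
  congr 1
  funext s
  fin_cases s
  · exact (hexpX 0).symm
  · exact (hexpX 1).symm

theorem frob_mul_scalar (a : Fq p) : frob p * scalar p a = scalar p (a ^ p) * frob p := by
  refine Endo.ext ?_
  have hp := (Fact.out (p := p.Prime)).ne_zero
  rw [frob_mul_series, Endo.series_mul]
  change (a • PowerSeries.X) ^ p = (a ^ p • PowerSeries.X : PowerSeries (Fq p)).subst
    (PowerSeries.X ^ p : PowerSeries (Fq p))
  rw [PowerSeries.subst_smul (PowerSeries.HasSubst.X_pow hp),
    PowerSeries.subst_X (PowerSeries.HasSubst.X_pow hp), smul_pow]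

@[simp] theorem derivAtZero_scalar (a : Fq p) : derivAtZero p (scalar p a) = a := by
  change PowerSeries.coeff 1 (a • PowerSeries.X) = a
  simp

theorem derivAtZero_add (f g : End p) :
    derivAtZero p (f + g) = derivAtZero p f + derivAtZero p g :=
  Endo.coeff_one_add f g

/-- The derivative at `0` as a ring homomorphism: reduction modulo the Frobenius. -/
def reduction : End p →+* Fq p :=
  RingHom.mk' (derivAtZero p) (derivAtZero_add p)

theorem reduction_apply (f : End p) : reduction p f = PowerSeries.coeff 1 f.series := rfl

@[simp] theorem reduction_scalar (a : Fq p) : reduction p (scalar p a) = a :=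
  derivAtZero_scalar p a

@[simp] theorem reduction_frob : reduction p (frob p) = 0 := by
  have := (Fact.out (p := p.Prime)).one_lt
  rw [reduction_apply]
  change PowerSeries.coeff 1 (PowerSeries.X ^ p) = 0
  rw [PowerSeries.coeff_X_pow, if_neg this.ne]

theorem isUnit_of_reduction_ne_zero {f : End p} (hf : reduction p f ≠ 0) : IsUnit f :=
  f.isUnit_of_isUnit_coeff_one (isUnit_iff_ne_zero.2 hf)

/-- Conjugation by the Frobenius: it acts on the residue field by `a ↦ a ^ p`. -/
theorem exists_frob_mul (f : End p) :
    ∃ g : End p, frob p * f = g * frob p ∧ reduction p g = reduction p f ^ p := by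
  obtain ⟨g, hg⟩ := exists_eq_mul_frob p (frob p * f) (by
    change reduction p _ = 0; rw [map_mul, reduction_frob, zero_mul])
  refine ⟨g, hg, ?_⟩
  have hp := (Fact.out (p := p.Prime)).pos
  have h := congrArg (fun f : End p => PowerSeries.coeff p f.series) hg
  simp only [coeff_mul_frob, frob_mul_series, dvd_refl, if_true, Nat.div_self hp] at h
  rw [reduction_apply, ← h, reduction_apply]
  obtain ⟨v, hv⟩ := PowerSeries.X_dvd_iff.2 f.constantCoeff_series
  rw [hv, mul_pow, PowerSeries.coeff_X_pow_mul', if_pos le_rfl, Nat.sub_self]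
  simp [PowerSeries.coeff_succ_X_mul (n := 0)]

/-- The left ideal of multiples of the `n`-th power of the Frobenius. -/
def J (n : ℕ) : Ideal (End p) := Ideal.span {frob p ^ n}

variable {p} in
theorem mem_J {n : ℕ} {f : End p} : f ∈ J p n ↔ ∃ g, f = g * frob p ^ n := by
  rw [J, Ideal.mem_span_singleton']
  simp only [eq_comm]

theorem exists_frob_pow_mul (f : End p) (n : ℕ) : ∃ g : End p,
    frob p ^ n * f = g * frob p ^ n ∧ reduction p g = reduction p f ^ p ^ n := by
  induction n with
  | zero => exact ⟨f, by simp⟩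
  | succ n ih =>
    obtain ⟨g, hg, hg'⟩ := ih
    obtain ⟨k, hk, hk'⟩ := exists_frob_mul p g
    exact ⟨k, by rw [pow_succ', mul_assoc, hg, ← mul_assoc, hk, mul_assoc],
      by rw [hk', hg', ← pow_mul, pow_succ]⟩

instance (n : ℕ) : (J p n).IsTwoSided where
  mul_mem_of_left := by
    intro f g hf
    obtain ⟨k, rfl⟩ := mem_J.1 hf
    obtain ⟨g', hg', -⟩ := exists_frob_pow_mul p g n
    exact mem_J.2 ⟨k * g', by rw [mul_assoc, hg', mul_assoc]⟩

variable {p}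

theorem J_anti {m n : ℕ} (h : m ≤ n) : J p n ≤ J p m := by
  intro f hf
  obtain ⟨g, rfl⟩ := mem_J.1 hf
  exact mem_J.2 ⟨g * frob p ^ (n - m), by rw [mul_assoc, ← pow_add, Nat.sub_add_cancel h]⟩

theorem mem_J_one {f : End p} : f ∈ J p 1 ↔ reduction p f = 0 := by
  rw [mem_J]
  constructor
  · rintro ⟨g, rfl⟩
    simp
  · intro h
    obtain ⟨g, hg⟩ := exists_eq_mul_frob p f h
    exact ⟨g, by rw [hg, pow_one]⟩

theorem mul_frob_pow_injective (n : ℕ) : Function.Injective fun f : End p => f * frob p ^ n := by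
  induction n with
  | zero => intro f g h; simpa using h
  | succ n ih =>
    intro f g h
    refine ih (mul_frob_injective p ?_)
    simpa [pow_succ, mul_assoc] using h

theorem mul_frob_pow_mem_J {m n : ℕ} {f : End p} : f * frob p ^ n ∈ J p (m + n) ↔ f ∈ J p m := by
  rw [mem_J, mem_J]
  refine exists_congr fun g => ?_
  rw [pow_add, ← mul_assoc]
  exact (mul_frob_pow_injective n).eq_iff

theorem mem_J_iff_dvd {n : ℕ} {f : End p} : f ∈ J p n ↔ PowerSeries.X ^ p ^ n ∣ f.series := by
  have hp := (Fact.out (p := p.Prime)).pos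
  induction n generalizing f with
  | zero =>
    simpa [mem_J] using PowerSeries.X_dvd_iff.2 f.constantCoeff_series
  | succ n ih =>
    have key : ∀ g : End p, PowerSeries.X ^ p ^ (n + 1) ∣ (g * frob p).series ↔
        PowerSeries.X ^ p ^ n ∣ g.series := by
      intro g
      simp only [PowerSeries.X_pow_dvd_iff, coeff_mul_frob]
      constructor
      · intro h m hm
        have := h (p * m) (by rw [pow_succ']; gcongr)
        simpa [hp] using this
      · intro h m hm
        split_ifs with hd
        · exact h _ (Nat.div_lt_of_lt_mul (by rwa [pow_succ'] at hm))
        · rfl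
    constructor
    · intro hf
      obtain ⟨g, rfl⟩ := mem_J.1 hf
      rw [pow_succ (frob p), ← mul_assoc, key]
      exact ih.1 (mem_J.2 ⟨g, rfl⟩)
    · intro hf
      obtain ⟨g, rfl⟩ := exists_eq_mul_frob p f
        (PowerSeries.X_pow_dvd_iff.1 hf 1
          (Nat.one_lt_pow n.succ_ne_zero (Fact.out (p := p.Prime)).one_lt))
      simpa using (mul_frob_pow_mem_J (n := 1)).2 (ih.2 ((key g).1 hf))

theorem eq_zero_of_forall_mem_J {f : End p} (h : ∀ n, f ∈ J p n) : f = 0 := by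
  refine Endo.ext (PowerSeries.ext fun n => ?_)
  exact PowerSeries.X_pow_dvd_iff.1 (mem_J_iff_dvd.1 (h n)) n
    (Nat.lt_pow_self (Fact.out (p := p.Prime)).one_lt)

/-- Endomorphisms are congruent modulo a power of the Frobenius if and only if the corresponding
coefficients agree. -/
theorem sub_mem_J_iff {n : ℕ} {f g : End p} :
    f - g ∈ J p n ↔ PowerSeries.X ^ p ^ n ∣ f.series - g.series := by
  have h0 : PowerSeries.constantCoeff (0 : PowerSeries (Fq p)) = 0 := map_zero _
  have key : ∀ {a b c : End p}, PowerSeries.X ^ p ^ n ∣ a.series - b.series →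
      PowerSeries.X ^ p ^ n ∣ (a + c).series - (b + c).series := fun {a b c} h =>
    dvd_pair_sub (Gam p).toPowerSeries a.constantCoeff_series b.constantCoeff_series
      c.constantCoeff_series c.constantCoeff_series h (by simp)
  rw [mem_J_iff_dvd]
  constructor
  · intro h
    simpa using key (a := f - g) (b := 0) (c := g) (by simpa using h)
  · intro h
    simpa [← sub_eq_add_neg] using key (c := -g) h

end Morava

/-! ### Commutation with the endomorphisms `a x` -/

namespace Morava

open FormalGroup

variable (p : ℕ) [Fact p.Prime]

theorem exists_pow_ne_self : ∃ ω : Fq p, ω ^ p ≠ ω := by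
  classical
  by_contra! h
  let _ : Fintype (Fq p) := Fintype.ofFinite _
  have hp := (Fact.out (p := p.Prime)).one_lt
  have hcard : Fintype.card (Fq p) = p ^ 2 := by
    rw [← Nat.card_eq_fintype_card, GaloisField.card p 2 two_ne_zero]
  have hne := FiniteField.X_pow_card_sub_X_ne_zero (Fq p) hp
  have hle := Polynomial.card_roots' (Polynomial.X ^ p - Polynomial.X : Polynomial (Fq p))
  rw [FiniteField.X_pow_card_sub_X_natDegree_eq (Fq p) hp] at hle
  have hsub : (Finset.univ : Finset (Fq p)) ⊆
      (Polynomial.X ^ p - Polynomial.X : Polynomial (Fq p)).roots.toFinset := by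
    intro x _
    rw [Multiset.mem_toFinset, Polynomial.mem_roots hne]
    simp [Polynomial.IsRoot, h x]
  have := (Finset.card_le_card hsub).trans (Multiset.toFinset_card_le _)
  rw [Finset.card_univ, hcard] at this
  nlinarith

variable {p}

theorem pow_sq_eq_self (a : Fq p) : a ^ p ^ 2 = a :=
  pow_eq_self p a (by simpa using Honda.pow_modEq_one p 1)
    (pow_ne_zero _ (Fact.out (p := p.Prime)).ne_zero)

theorem scalar_commute (a b : Fq p) : Commute (scalar p a) (scalar p b) := by
  rw [Commute, SemiconjBy, ← scalar_mul, ← scalar_mul, mul_comm]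

theorem frob_sq_commute_scalar (a : Fq p) : Commute (frob p ^ 2) (scalar p a) := by
  rw [Commute, SemiconjBy, pow_two, mul_assoc, frob_mul_scalar, ← mul_assoc, frob_mul_scalar,
    mul_assoc, ← pow_mul, ← pow_two, pow_sq_eq_self]

/-- If `h` satisfies `ω h = h ω ^ p`, then it is divisible by the Frobenius, with a quotient that
commutes with `ω`. -/
theorem exists_commute_of_semiconj {ω : Fq p} (hω : ω ^ p ≠ ω) {h : End p}
    (hh : scalar p ω * h = h * scalar p (ω ^ p)) :
    ∃ g, h = g * frob p ∧ Commute (scalar p ω) g := by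
  have h0 : reduction p h = 0 := by
    have := congrArg (reduction p) hh
    simp only [map_mul, reduction_scalar] at this
    have h' : (ω ^ p - ω) * reduction p h = 0 := by linear_combination -this
    exact (mul_eq_zero.1 h').resolve_left (sub_ne_zero.2 hω)
  obtain ⟨g, rfl⟩ := exists_eq_mul_frob p h h0
  refine ⟨g, rfl, mul_frob_injective p ?_⟩
  dsimp only
  rw [mul_assoc, hh, mul_assoc g, frob_mul_scalar, ← pow_mul, ← pow_two, pow_sq_eq_self, mul_assoc]

/-- An endomorphism commuting with `ω x` has no term of degree one in the Frobenius. -/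
theorem exists_commute_of_commute {ω : Fq p} (hω : ω ^ p ≠ ω) {h : End p}
    (hh : Commute (scalar p ω) h) (h0 : reduction p h = 0) :
    ∃ g, h = g * frob p ^ 2 ∧ Commute (scalar p ω) g := by
  obtain ⟨k, rfl⟩ := exists_eq_mul_frob p h h0
  obtain ⟨g, rfl, hg⟩ := exists_commute_of_semiconj hω (h := k) (mul_frob_injective p (by
    dsimp only
    rw [mul_assoc, hh.eq, mul_assoc, mul_assoc, frob_mul_scalar]))
  exact ⟨g, by rw [mul_assoc, pow_two], hg⟩

/-- The map `a ↦ a x` is additive modulo the square of the Frobenius. -/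
theorem scalar_add_mem_J (a b : Fq p) :
    scalar p a + scalar p b - scalar p (a + b) ∈ J p 2 := by
  obtain ⟨ω, hω⟩ := exists_pow_ne_self p
  obtain ⟨g, hg, -⟩ := exists_commute_of_commute hω
    (((scalar_commute ω a).add_right (scalar_commute ω b)).sub_right (scalar_commute ω (a + b)))
    (by simp)
  exact mem_J.2 ⟨g, hg⟩

theorem scalar_zero : scalar p 0 = 0 := Endo.ext (zero_smul _ _)

theorem scalar_one : scalar p 1 = 1 := Endo.ext (one_smul _ _)

/-! ### Multiplication by `p` -/

theorem constantCoeff_map_eq_zero {R S : Type*} [CommRing R] [CommRing S] (f : R →+* S)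
    {P : PowerSeries R} (hP : PowerSeries.constantCoeff P = 0) :
    PowerSeries.constantCoeff (PowerSeries.map f P) = 0 := by
  rw [← PowerSeries.coeff_zero_eq_constantCoeff_apply] at hP ⊢
  rw [PowerSeries.coeff_map, hP, map_zero]

/-- Multiplication by an integer lifts to characteristic zero, where the logarithm turns it into a
multiple. -/
theorem exists_lift_natCast (n : ℕ) : ∃ P : PowerSeries ℤ_[p],
    PowerSeries.constantCoeff P = 0 ∧
    (Honda.log p).subst (PowerSeries.map (algebraMap ℤ_[p] ℚ_[p]) P) =
      (n : ℚ_[p]) • Honda.log p ∧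
    (n : End p).series =
      PowerSeries.map ((algebraMap (ZMod p) (Fq p)).comp PadicInt.toZMod) P := by
  induction n with
  | zero =>
    refine ⟨0, map_zero _, ?_, by simp⟩
    rw [map_zero, Nat.cast_zero, zero_smul]
    exact PowerSeries.subst_zero_of_constantCoeff_zero (Honda.constantCoeff_log p)
  | succ n ih =>
    obtain ⟨P, hP0, hlog, hser⟩ := ih
    have hP : PowerSeries.HasSubst P := hasSubst_of_zero hP0
    have hX : ∀ (A : Type) [CommRing A], PowerSeries.HasSubst (PowerSeries.X : PowerSeries A) :=
      fun A _ => PowerSeries.HasSubst.X'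
    have hPQ : PowerSeries.HasSubst (PowerSeries.map (algebraMap ℤ_[p] ℚ_[p]) P) :=
      hasSubst_of_zero (constantCoeff_map_eq_zero _ hP0)
    refine ⟨(Honda.integralSeries p).subst ![P, PowerSeries.X],
      constantCoeff_pair (Honda.constantCoeff_integralSeries p) hP0 (by simp), ?_, ?_⟩
    · have h := Honda.map_integralSeries_subst p hP (hX ℤ_[p])
      have hXm : MvPowerSeries.map (algebraMap ℤ_[p] ℚ_[p]) PowerSeries.X =
        (PowerSeries.X : PowerSeries ℚ_[p]) := PowerSeries.map_X _
      rw [hXm] at h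
      rw [PowerSeries.map, h]
      change (Honda.log p).subst ((Honda.rationalSeries p).subst
        ![PowerSeries.map (algebraMap ℤ_[p] ℚ_[p]) P, PowerSeries.X]) = _
      rw [Honda.log_rationalSeries_subst p hPQ (hX ℚ_[p])]
      change PowerSeries.subst (PowerSeries.map (algebraMap ℤ_[p] ℚ_[p]) P) (Honda.log p) +
        PowerSeries.subst (PowerSeries.X : PowerSeries ℚ_[p]) (Honda.log p) = _
      rw [hlog, PowerSeries.X_subst, Nat.cast_succ, add_smul, one_smul]
    · rw [Nat.cast_succ, Endo.series_sum, hser, Endo.series_one]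
      change _ = MvPowerSeries.map _ _
      rw [MvPowerSeries.map_subst (hasSubst_pair hP (hX ℤ_[p]))]
      have hG : (Gam p).toPowerSeries = MvPowerSeries.map
          ((algebraMap (ZMod p) (Fq p)).comp PadicInt.toZMod) (Honda.integralSeries p) := rfl
      rw [hG]
      congr 1
      funext s
      fin_cases s
      · rfl
      · exact (PowerSeries.map_X _).symm

theorem coeff_pow_self_of_constantCoeff {R : Type*} [CommRing R] {A : PowerSeries R}
    (hA : PowerSeries.constantCoeff A = 0) (n : ℕ) :
    PowerSeries.coeff n (A ^ n) = PowerSeries.coeff 1 A ^ n := by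
  obtain ⟨v, hv⟩ := PowerSeries.X_dvd_iff.2 hA
  rw [hv, mul_pow, PowerSeries.coeff_X_pow_mul', if_pos le_rfl, Nat.sub_self]
  simp [PowerSeries.coeff_succ_X_mul (n := 0)]

/-- The coefficient of `x ^ (p ^ 2)` in the `p`-series of the Honda formal group law is `1`. -/
theorem coeff_sq_natCast : PowerSeries.coeff (p ^ 2) (p : End p).series = 1 := by
  obtain ⟨P, hP0, hlog, hser⟩ := exists_lift_natCast (p := p) p
  -- only the first two terms of the logarithm contribute in degrees up to `p ^ 2`
  set A := PowerSeries.map (algebraMap ℤ_[p] ℚ_[p]) P with hA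
  have hA0 : PowerSeries.constantCoeff A = 0 := constantCoeff_map_eq_zero _ hP0
  have hp := (Fact.out (p := p.Prime))
  have hq := Honda.one_lt_q p
  have hpQ : (p : ℚ_[p]) ≠ 0 := by exact_mod_cast hp.ne_zero
  have key : ∀ n, n ≤ p ^ 2 → PowerSeries.coeff n A +
      (p : ℚ_[p])⁻¹ * PowerSeries.coeff n (A ^ p ^ 2) =
        p * PowerSeries.coeff n (Honda.log p) := by
    intro n hn
    have h := congrArg (PowerSeries.coeff n) hlog
    rw [PowerSeries.coeff_smul, smul_eq_mul] at h
    rw [← h, PowerSeries.coeff, Honda.coeff_log_subst p (N := n + 2) hA0 (by simp),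
      Finset.sum_eq_add_of_mem 0 1 (by simp) (by simp) (by simp)]
    · simp
    · intro k _ hk
      have h2 : p ^ 2 < (p ^ 2) ^ k := by
        simpa using Nat.pow_lt_pow_right hq (show 1 < k by omega)
      rw [Honda.coeff_pow_eq_zero hA0 (by simp; omega), mul_zero]
  have h1 : PowerSeries.coeff 1 A = p := by
    have h := key 1 hq.le
    have h0 : PowerSeries.coeff 1 (A ^ p ^ 2) = 0 :=
      Honda.coeff_pow_eq_zero hA0 (by rwa [Finsupp.degree_single])
    rw [Honda.coeff_log_one, h0] at h
    simpa using h
  have h2 := key (p ^ 2) le_rfl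
  have h3 : PowerSeries.coeff (p ^ 2) (Honda.log p) = (p : ℚ_[p])⁻¹ := by
    simpa using Honda.coeff_log_pow p 1
  rw [coeff_pow_self_of_constantCoeff hA0, h1, h3, mul_inv_cancel₀ hpQ] at h2
  have h4 : PowerSeries.coeff (p ^ 2) P = 1 - (p : ℤ_[p]) ^ (p ^ 2 - 1) := by
    apply Honda.algebraMap_inj p
    rw [← PowerSeries.coeff_map, ← hA, map_sub, map_one, map_pow, map_natCast]
    have h5 : (p : ℚ_[p]) ^ p ^ 2 = p * (p : ℚ_[p]) ^ (p ^ 2 - 1) := by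
      rw [← pow_succ', Nat.sub_add_cancel hq.le]
    rw [h5, ← mul_assoc, inv_mul_cancel₀ hpQ, one_mul] at h2
    exact eq_sub_of_add_eq h2
  rw [hser, PowerSeries.coeff_map, h4, map_sub, map_one, map_pow, map_natCast,
    CharP.cast_eq_zero (Fq p) p, zero_pow (by omega), sub_zero]

/-- The endomorphism `p` is the square of the Frobenius up to an automorphism; in other words, the
height of `Γ₂` is `2`. -/
theorem exists_natCast_eq {ω : Fq p} (hω : ω ^ p ≠ ω) : ∃ u : (End p)ˣ,
    (p : End p) = u * frob p ^ 2 ∧ Commute (scalar p ω) u := by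
  have hp := (Fact.out (p := p.Prime)).pos
  obtain ⟨u, hu, hc⟩ := exists_commute_of_commute hω (Nat.cast_commute p (scalar p ω)).symm
    (by simp)
  have h1 : reduction p u = 1 := by
    have h := coeff_sq_natCast (p := p)
    rw [hu, pow_two, pow_two, ← mul_assoc, coeff_mul_frob, if_pos (dvd_mul_right _ _),
      Nat.mul_div_cancel _ hp, coeff_mul_frob, if_pos dvd_rfl, Nat.div_self hp] at h
    exact h
  obtain ⟨v, rfl⟩ := isUnit_of_reduction_ne_zero p (f := u) (by rw [h1]; exact one_ne_zero)
  exact ⟨v, hu, hc⟩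

end Morava

namespace Morava

open FormalGroup

variable {p : ℕ} [Fact p.Prime]

/-! ### The Witt vectors in the endomorphism ring -/

theorem commute_of_mem_witt {f : End p} (hf : f ∈ witt p) (a : Fq p) : Commute (scalar p a) f := by
  have hle : witt p ≤ Subring.centralizer {scalar p a} := by
    refine Subring.topologicalClosure_minimal _ ?_ (Set.isClosed_centralizer _)
    rw [Subring.closure_le]
    rintro _ ⟨b, rfl⟩
    rw [SetLike.mem_coe, Subring.mem_centralizer_iff]
    rintro _ rfl
    exact scalar_commute a b
  exact Subring.mem_centralizer_iff.1 (hle hf) _ rfl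

/-- Endomorphisms commuting with `ω x` are approximated by the ring generated by the `a x`: after
subtracting its leading term `a₀ x`, such an endomorphism is a multiple of `p`. -/
theorem exists_mem_closure_sub_mem_J {ω : Fq p} (hω : ω ^ p ≠ ω) (n : ℕ) (f : End p)
    (hf : Commute (scalar p ω) f) :
    ∃ u ∈ Subring.closure (Set.range (scalar p)), f - u ∈ J p (2 * n) := by
  induction n generalizing f with
  | zero => exact ⟨0, zero_mem _, mem_J.2 ⟨f, by simp⟩⟩
  | succ n ih =>
    obtain ⟨u, hu, hcu⟩ := exists_natCast_eq hω
    obtain ⟨g, hg, hcg⟩ := exists_commute_of_commute hω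
      (hf.sub_right (scalar_commute ω (reduction p f))) (by simp)
    obtain ⟨v, hv, hgv⟩ := ih (g * ((u⁻¹ : (End p)ˣ) : End p)) (hcg.mul_right hcu.units_inv_right)
    refine ⟨scalar p (reduction p f) + v * p, add_mem (Subring.subset_closure ⟨_, rfl⟩)
      (mul_mem hv (natCast_mem _ p)), ?_⟩
    have h : f - (scalar p (reduction p f) + v * p) =
        (g * ((u⁻¹ : (End p)ˣ) : End p) - v) * u * frob p ^ 2 := by
      rw [← sub_sub, hg, hu, sub_mul, sub_mul, Units.inv_mul_cancel_right, mul_assoc]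
    rw [h, mul_add_one, mul_frob_pow_mem_J]
    exact Ideal.mul_mem_right _ _ hgv

/-- The Witt vectors are the centralizer of a single endomorphism `ω x`, for `ω` outside the prime
field. -/
theorem mem_witt_iff {ω : Fq p} (hω : ω ^ p ≠ ω) {f : End p} :
    f ∈ witt p ↔ Commute (scalar p ω) f := by
  refine ⟨fun hf => commute_of_mem_witt hf ω, fun hf => ?_⟩
  change f ∈ closure _
  rw [mem_closure_iff_nhds]
  intro t ht
  obtain ⟨n, hn⟩ := (Endo.mem_nhds_iff f t).1 ht
  obtain ⟨u, hu, hfu⟩ := exists_mem_closure_sub_mem_J hω n f hf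
  refine ⟨u, hn u ?_, hu⟩
  rw [← neg_mem_iff, neg_sub, sub_mem_J_iff] at hfu
  refine (pow_dvd_pow _ ?_).trans hfu
  have := Nat.lt_pow_self (n := 2 * n) (Fact.out (p := p.Prime)).one_lt
  omega

theorem frob_sq_mem_witt : frob p ^ 2 ∈ witt p := by
  obtain ⟨ω, hω⟩ := exists_pow_ne_self p
  exact (mem_witt_iff hω).2 (frob_sq_commute_scalar ω).symm

theorem frob_pow_mem_witt (k : ℕ) : frob p ^ (2 * k) ∈ witt p := by
  rw [pow_mul]
  exact pow_mem frob_sq_mem_witt k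

/-- Conjugation by the Frobenius acts on the Witt vectors. -/
theorem exists_frob_mul_mem_witt {α : End p} (hα : α ∈ witt p) :
    ∃ α' ∈ witt p, frob p * α = α' * frob p ∧ reduction p α' = reduction p α ^ p := by
  obtain ⟨ω, hω⟩ := exists_pow_ne_self p
  obtain ⟨α', h, h'⟩ := exists_frob_mul p α
  refine ⟨α', (mem_witt_iff hω).2 (mul_frob_injective p ?_), h, h'⟩
  have h1 : scalar p ω * frob p = frob p * scalar p (ω ^ p) := by
    rw [frob_mul_scalar, ← pow_mul, ← pow_two, pow_sq_eq_self]
  dsimp only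
  rw [mul_assoc, ← h, ← mul_assoc, h1, mul_assoc, (commute_of_mem_witt hα _).eq, ← mul_assoc, h,
    mul_assoc, ← h1, mul_assoc]

/-- Every endomorphism is the sum of a Witt vector and a multiple of the Frobenius by a
Witt vector: the two summands are characterized by `ω f = f ω` and `ω f = f ω ^ p`. -/
theorem exists_eq_witt_add (f : End p) :
    ∃ α ∈ witt p, ∃ β ∈ witt p, f = α + β * frob p := by
  obtain ⟨ω, hω⟩ := exists_pow_ne_self p
  set w := scalar p ω with hw
  set w' := scalar p (ω ^ p) with hw'
  have hww : w * w' = w' * w := scalar_commute ω (ω ^ p)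
  obtain ⟨δ, hδ⟩ : IsUnit (w' - w) := isUnit_of_reduction_ne_zero p (by
    simpa [hw, hw'] using sub_ne_zero.2 hω)
  have hcw : Commute w (δ : End p) := by
    rw [hδ]
    exact Commute.sub_right hww (Commute.refl w)
  have hcw' : Commute w' (δ : End p) := by
    rw [hδ]
    exact Commute.sub_right (Commute.refl w') hww.symm
  -- the two conditions applied in succession annihilate every endomorphism
  have hT : ∀ f : End p, w * (w * f - f * w') - (w * f - f * w') * w = 0 := by
    intro f
    refine eq_zero_of_forall_mem_J fun n => ?_
    induction n generalizing f with
    | zero => exact mem_J.2 ⟨_, by rw [pow_zero, mul_one]⟩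
    | succ n ih =>
      obtain ⟨g, hg⟩ := exists_eq_mul_frob p (f - scalar p (reduction p f))
        (show reduction p _ = 0 by simp)
      have hf : f = scalar p (reduction p f) + g * frob p := by rw [← hg]; abel
      have ha : w * scalar p (reduction p f) = scalar p (reduction p f) * w := scalar_commute _ _
      have hS : frob p * w = w' * frob p := frob_mul_scalar p ω
      have hS' : frob p * w' = w * frob p := by
        rw [hw', frob_mul_scalar, ← pow_mul, ← pow_two, pow_sq_eq_self]
      have h : w * (w * f - f * w') - (w * f - f * w') * w =
          (w * (w * g - g * w') - (w * g - g * w') * w) * frob p := by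
        rw [hf]
        generalize scalar p (reduction p f) = a at ha
        simp only [mul_add, add_mul, mul_sub, sub_mul, mul_assoc, hS, hS', ha]
        simp only [← mul_assoc, ha]
        simp only [mul_assoc, hww]
        simp only [← mul_assoc]
        abel
      rw [h]
      simpa using mul_frob_pow_mem_J (n := 1).2 (ih g)
  -- `f δ = (ω f - f ω) - (ω f - f ω ^ p)`, and `δ` is invertible
  have hT' : ∀ f : End p, w * (w * f - f * w) = (w * f - f * w) * w' := fun f => by
    have := hT f
    rw [← sub_eq_zero, ← this]
    simp only [mul_sub, sub_mul, mul_assoc, hww]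
    abel
  have hα : Commute w ((f * w' - w * f) * ((δ⁻¹ : (End p)ˣ) : End p)) := by
    refine Commute.mul_right ?_ hcw.units_inv_right
    have := hT f
    rw [← neg_sub (w * f)]
    exact Commute.neg_right (sub_eq_zero.1 this)
  obtain ⟨β, hβ, hcβ⟩ := exists_commute_of_semiconj hω
    (h := (w * f - f * w) * ((δ⁻¹ : (End p)ˣ) : End p)) (by
      rw [← mul_assoc, hT' f, mul_assoc, mul_assoc, hcw'.units_inv_right.eq])
  refine ⟨_, (mem_witt_iff hω).2 hα, β, (mem_witt_iff hω).2 hcβ, ?_⟩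
  rw [← hβ, ← add_mul, Units.eq_mul_inv_iff_mul_eq, hδ, mul_sub]
  abel

theorem eq_zero_of_witt_add_eq_zero {α β : End p} (hα : α ∈ witt p) (hβ : β ∈ witt p)
    (h : α + β * frob p = 0) : α = 0 ∧ β = 0 := by
  obtain ⟨ω, hω⟩ := exists_pow_ne_self p
  obtain ⟨δ, hδ⟩ : IsUnit (scalar p ω - scalar p (ω ^ p)) := isUnit_of_reduction_ne_zero p (by
    simpa using sub_ne_zero.2 hω.symm)
  have h1 : β * (scalar p ω - scalar p (ω ^ p)) = 0 := by
    refine mul_frob_injective p ?_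
    have e := (commute_of_mem_witt hα ω).eq
    rw [eq_neg_of_add_eq_zero_left h, mul_neg, neg_mul, neg_inj, mul_assoc, frob_mul_scalar,
      ← mul_assoc, (commute_of_mem_witt hβ ω).eq] at e
    dsimp only
    rw [mul_sub, sub_mul, e, mul_assoc, sub_self, zero_mul]
  rw [← hδ, Units.mul_left_eq_zero] at h1
  exact ⟨by simpa [h1] using h, h1⟩

/-- The basis `1, x ^ p` of the endomorphism ring over the Witt vectors. -/
def wittBasis (p : ℕ) [Fact p.Prime] : Module.Basis (Fin 2) (witt p) (End p) :=
  Module.Basis.mk (v := ![1, frob p])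
    (LinearIndependent.pair_iff.2 fun s t h => by
      have := eq_zero_of_witt_add_eq_zero s.2 t.2 (by simpa [Subring.smul_def] using h)
      exact ⟨Subtype.ext this.1, Subtype.ext this.2⟩)
    (fun f _ => by
      obtain ⟨α, hα, β, hβ, rfl⟩ := exists_eq_witt_add f
      rw [Matrix.range_cons, Matrix.range_cons, Matrix.range_empty, Set.union_empty,
        Set.singleton_union, Submodule.mem_span_pair]
      exact ⟨⟨α, hα⟩, ⟨β, hβ⟩, by simp [Subring.smul_def]⟩)

theorem wittBasis_zero : wittBasis p 0 = 1 := by simp [wittBasis]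

theorem wittBasis_one : wittBasis p 1 = frob p := by simp [wittBasis]

theorem det_mulRight {α β α' β' : End p} (hα : α ∈ witt p) (hβ : β ∈ witt p) (hα' : α' ∈ witt p)
    (hβ' : β' ∈ witt p) (hαα : frob p * α = α' * frob p) (hββ : frob p * β = β' * frob p) :
    ((LinearMap.det (LinearMap.mulRight (witt p) (α + β * frob p)) : witt p) : End p) =
      α * α' - β' * frob p ^ 2 * β := by
  have h0 : LinearMap.mulRight (witt p) (α + β * frob p) (wittBasis p 0) =
      (⟨α, hα⟩ : witt p) • wittBasis p 0 + (⟨β, hβ⟩ : witt p) • wittBasis p 1 := by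
    simp [wittBasis_zero, wittBasis_one, Subring.smul_def]
  have h1 : LinearMap.mulRight (witt p) (α + β * frob p) (wittBasis p 1) =
      (⟨β', hβ'⟩ * ⟨frob p ^ 2, frob_sq_mem_witt⟩ : witt p) • wittBasis p 0 +
        (⟨α', hα'⟩ : witt p) • wittBasis p 1 := by
    simp only [wittBasis_zero, wittBasis_one, Subring.smul_def, LinearMap.mulRight_apply, mul_add,
      hαα, ← mul_assoc, hββ, smul_eq_mul, mul_one, Subring.coe_mul, pow_two]
    abel
  rw [← LinearMap.det_toMatrix (wittBasis p), Matrix.det_fin_two]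
  simp only [LinearMap.toMatrix_apply, h0, h1, map_add, map_smul, Module.Basis.repr_self,
    Finsupp.add_apply, Finsupp.smul_apply, Finsupp.single_apply]
  simp

end Morava

namespace Morava

open FormalGroup
open scoped commutatorElement

variable {p : ℕ} [Fact p.Prime]

/-! ### The filtration of the group `S₂¹` -/

theorem mem_S21_iff {f : Aut p} :
    f ∈ S21 p ↔ reduction p (f : End p) = 1 ∧ det p f = 1 := by
  rw [S21, Subgroup.mem_inf, S2, MonoidHom.mem_ker, MonoidHom.mem_ker, Units.ext_iff]
  rfl

/-- Commutators in the full automorphism group already lie in `S₂¹`, as the derivative at `0` and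
the determinant take commuting values. -/
theorem commutator_mem_S21 (g h : Aut p) : ⁅g, h⁆ ∈ S21 p := by
  rw [S21, Subgroup.mem_inf, S2, MonoidHom.mem_ker, MonoidHom.mem_ker]
  refine ⟨by rw [map_commutatorElement, commutatorElement_eq_one_iff_mul_comm, mul_comm], ?_⟩
  have hg : det p g * det p g⁻¹ = 1 := by rw [← map_mul, mul_inv_cancel, map_one]
  have hh : det p h * det p h⁻¹ = 1 := by rw [← map_mul, mul_inv_cancel, map_one]
  rw [commutatorElement_def, map_mul, map_mul, map_mul, mul_right_comm (det p g), hg, one_mul, hh]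

theorem commutator_sub_one_mul (g h : Aut p) :
    (((⁅g, h⁆ : Aut p) : End p) - 1) * (h * g) = g * h - h * g := by
  have e : ⁅g, h⁆ * (h * g) = g * h := by rw [commutatorElement_def]; group
  have e' := congrArg Units.val e
  simp only [Units.val_mul] at e'
  rw [sub_mul, e', one_mul]

/-- The leading term of a commutator. -/
theorem exists_commutator_sub_one_eq (g h : Aut p) (n : ℕ) (x : End p)
    (hx : (g : End p) * h - h * g = x * frob p ^ n) :
    ∃ r, ((⁅g, h⁆ : Aut p) : End p) - 1 = r * frob p ^ n ∧
      reduction p r * (reduction p h * reduction p g) ^ p ^ n = reduction p x := by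
  have h1 := commutator_sub_one_mul g h
  have hmem : ((⁅g, h⁆ : Aut p) : End p) - 1 ∈ J p n := by
    have h2 : (((⁅g, h⁆ : Aut p) : End p) - 1) * ((h * g : Aut p) : End p) ∈ J p n := by
      rw [Units.val_mul, h1, hx]
      exact mem_J.2 ⟨x, rfl⟩
    have h3 := Ideal.mul_mem_right (((h * g)⁻¹ : Aut p) : End p) _ h2
    rwa [Units.mul_inv_cancel_right] at h3
  obtain ⟨r, hr⟩ := mem_J.1 hmem
  obtain ⟨k, hk, hk'⟩ := exists_frob_pow_mul p ((h : End p) * g) n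
  refine ⟨r, hr, ?_⟩
  rw [hr, hx, mul_assoc, hk, ← mul_assoc] at h1
  rw [← mul_frob_pow_injective n h1, map_mul, hk', map_mul]

/-- The leading term of the commutator of `1 + a S ^ m` and `1 + b S ^ n`, where `S` is the
Frobenius. -/
theorem exists_commutator_one_add (g h : Aut p) {m n : ℕ} (hm : m ≠ 0) (hn : n ≠ 0) (a b : End p)
    (hg : (g : End p) = 1 + a * frob p ^ m) (hh : (h : End p) = 1 + b * frob p ^ n) :
    ∃ r, ((⁅g, h⁆ : Aut p) : End p) - 1 = r * frob p ^ (m + n) ∧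
      reduction p r =
        reduction p a * reduction p b ^ p ^ m - reduction p b * reduction p a ^ p ^ n := by
  obtain ⟨b', hb, hb'⟩ := exists_frob_pow_mul p b m
  obtain ⟨a', ha, ha'⟩ := exists_frob_pow_mul p a n
  obtain ⟨r, hr, hr'⟩ := exists_commutator_sub_one_eq g h (m + n) (a * b' - b * a') (by
    have h1 : a * frob p ^ m * (b * frob p ^ n) = a * b' * frob p ^ (m + n) := by
      rw [pow_add, mul_assoc a, ← mul_assoc _ b, hb]; simp only [mul_assoc]
    have h2 : b * frob p ^ n * (a * frob p ^ m) = b * a' * frob p ^ (m + n) := by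
      rw [add_comm m n, pow_add, mul_assoc b, ← mul_assoc _ a, ha]; simp only [mul_assoc]
    rw [hg, hh, sub_mul, ← h1, ← h2]
    noncomm_ring)
  refine ⟨r, hr, ?_⟩
  rw [hg, hh] at hr'
  simpa [hm, hn, ha', hb'] using hr'

theorem exists_unit_eq_one_add (a : End p) {n : ℕ} (hn : n ≠ 0) :
    ∃ g : Aut p, (g : End p) = 1 + a * frob p ^ n := by
  obtain ⟨g, hg⟩ := isUnit_of_reduction_ne_zero p (f := 1 + a * frob p ^ n) (by simp [hn])
  exact ⟨g, hg⟩

theorem pow_pow_of_even (a : Fq p) {n : ℕ} (hn : Even n) : a ^ p ^ n = a := by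
  obtain ⟨k, rfl⟩ := hn
  rw [← two_mul]
  induction k with
  | zero => simp
  | succ k ih => rw [mul_add_one, pow_add, pow_mul, ih, pow_sq_eq_self]

theorem pow_pow_of_odd (a : Fq p) {n : ℕ} (hn : Odd n) : a ^ p ^ n = a ^ p := by
  obtain ⟨k, rfl⟩ := hn
  rw [pow_succ, pow_mul, pow_pow_of_even a (even_two_mul k)]

/-- In odd degree, every element of the field is the leading coefficient of an element of `S₂¹`,
namely of a commutator with some `ω x`. -/
theorem exists_mem_S21_of_odd {n : ℕ} (hn : Odd n) (a : Fq p) :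
    ∃ f ∈ S21 p, ∃ r, (f : End p) = 1 + r * frob p ^ n ∧ reduction p r = a := by
  obtain ⟨ω, hω⟩ := exists_pow_ne_self p
  have hn0 : n ≠ 0 := by rintro rfl; simp at hn
  have hω0 : ω ≠ 0 := by
    rintro rfl
    exact hω (zero_pow (Fact.out (p := p.Prime)).ne_zero)
  have hd : ω - ω ^ p ≠ 0 := sub_ne_zero.2 hω.symm
  -- the commutator of `ω` and `1 + b S ^ n` has leading coefficient `b (ω - ω ^ p) / ω ^ p`
  set b := a * ω ^ p / (ω - ω ^ p) with hb
  obtain ⟨h, hh⟩ := exists_unit_eq_one_add (scalar p b) hn0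
  have hg : ((scalarUnit p (Units.mk0 ω hω0) : Aut p) : End p) = scalar p ω := rfl
  obtain ⟨c, hc, hc'⟩ := exists_frob_pow_mul p (scalar p ω) n
  obtain ⟨r, hr, hr'⟩ := exists_commutator_sub_one_eq (scalarUnit p (Units.mk0 ω hω0)) h n
    (scalar p ω * scalar p b - scalar p b * c) (by
      rw [hg, hh, sub_mul, mul_assoc (scalar p b) c, ← hc]
      noncomm_ring)
  refine ⟨_, commutator_mem_S21 _ _, r, by rw [← hr]; abel, ?_⟩
  rw [hg, hh] at hr'
  simp only [map_add, map_sub, map_mul, map_one, map_pow, reduction_scalar, reduction_frob, hc',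
    zero_pow hn0, mul_zero, _root_.add_zero, one_mul, pow_pow_of_odd _ hn] at hr'
  have hωp : ω ^ p ≠ 0 := pow_ne_zero _ hω0
  refine mul_right_cancel₀ hωp (hr'.trans ?_)
  rw [hb]
  field_simp

theorem two_ne_zero_of_lt (hp : 2 < p) : (2 : Fq p) ≠ 0 := by
  intro h
  have h2 : ((2 : ℕ) : Fq p) = 0 := by exact_mod_cast h
  exact hp.not_ge (Nat.le_of_dvd two_pos ((CharP.cast_eq_zero_iff (Fq p) p 2).1 h2))

theorem two_pow_char : (2 : Fq p) ^ p = 2 := by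
  have := map_ofNat (frobenius (Fq p) p) 2
  rwa [frobenius_def] at this

theorem div_two_pow_char (a : Fq p) : (a / 2) ^ p = a ^ p / 2 := by
  rw [div_pow, two_pow_char]

/-- The determinant condition: the leading coefficient of an element of `S₂¹` in even degree has
trace zero. -/
theorem pow_eq_neg_of_mem_S21 {f : Aut p} (hf : f ∈ S21 p) {k : ℕ} (hk : k ≠ 0) {r : End p}
    (hr : (f : End p) = 1 + r * frob p ^ (2 * k)) : reduction p r ^ p = -reduction p r := by
  obtain ⟨α, hα, β, hβ, rfl⟩ := exists_eq_witt_add r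
  obtain ⟨α', hα', hαα, hα0⟩ := exists_frob_mul_mem_witt hα
  obtain ⟨β', hβ', hββ, -⟩ := exists_frob_mul_mem_witt hβ
  set z := frob p ^ (2 * k) with hz
  have hzw : z ∈ witt p := frob_pow_mem_witt k
  have hzS : frob p * z = z * frob p := by rw [hz, ← pow_succ, ← pow_succ']
  have hcomm : ∀ {x y : End p}, x ∈ witt p → y ∈ witt p → x * y = y * x := fun hx hy =>
    congrArg Subtype.val (mul_comm (⟨_, hx⟩ : witt p) ⟨_, hy⟩)
  have hf' : (f : End p) = (1 + α * z) + (β * z) * frob p := by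
    rw [hr, add_mul, mul_assoc β, hzS, mul_assoc, add_assoc]
  have hdet : ((det p f : witt p) : End p) = 1 := by rw [(mem_S21_iff.1 hf).2]; rfl
  have key := det_mulRight (α := 1 + α * z) (β := β * z) (α' := 1 + α' * z) (β' := β' * z)
    (add_mem (one_mem _) (mul_mem hα hzw)) (mul_mem hβ hzw)
    (add_mem (one_mem _) (mul_mem hα' hzw)) (mul_mem hβ' hzw)
    (by rw [mul_add, add_mul, mul_one, one_mul, ← mul_assoc, hαα, mul_assoc, hzS, mul_assoc])
    (by rw [← mul_assoc, hββ, mul_assoc, hzS, mul_assoc])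
  rw [← hf', show LinearMap.det (LinearMap.mulRight (witt p) (f : End p)) = det p f from rfl,
    hdet] at key
  have h0 : (α + α' + α * z * α' - β' * z * frob p ^ 2 * β) * z = 0 := by
    have e1 : z * α' = α' * z := hcomm hzw hα'
    have e : (1 + α * z) * (1 + α' * z) - β' * z * frob p ^ 2 * (β * z) - 1 =
        (α + α' + α * z * α' - β' * z * frob p ^ 2 * β) * z := by
      noncomm_ring
    rw [← e, ← key, sub_self]
  have h1 := mul_frob_pow_injective (2 * k) (a₁ := _) (a₂ := 0) (by simpa using h0)
  have h2 := congrArg (reduction p) h1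
  have hz0 : reduction p z = 0 := by rw [hz, map_pow, reduction_frob, zero_pow (by omega)]
  simp only [map_add, map_sub, map_mul, hz0, reduction_frob, hα0, mul_zero, zero_mul, _root_.add_zero,
    sub_zero, map_zero] at h2 ⊢
  linear_combination h2

/-- In degree two, every element of trace zero is the leading coefficient of an element of `S₂¹`. -/
theorem exists_mem_S21_two (hp : 2 < p) {b : Fq p} (hb : b ^ p = -b) :
    ∃ f ∈ S21 p, ∃ r, (f : End p) = 1 + r * frob p ^ 2 ∧ reduction p r = b := by
  have h2 := two_ne_zero_of_lt hp
  obtain ⟨g, hg⟩ := exists_unit_eq_one_add (scalar p (b / 2)) one_ne_zero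
  obtain ⟨h, hh⟩ := exists_unit_eq_one_add (1 : End p) one_ne_zero
  obtain ⟨r, hr, hr'⟩ := exists_commutator_one_add g h one_ne_zero one_ne_zero _ _ hg hh
  refine ⟨_, commutator_mem_S21 g h, r, eq_add_of_sub_eq' hr, ?_⟩
  rw [hr', reduction_scalar, map_one, one_pow, pow_one, div_two_pow_char, hb]
  field_simp
  ring

/-- From the second step of the filtration on, every element of `S₂¹` agrees to leading order with
a commutator of elements of `S₂¹`. -/
theorem exists_commutator_sub_mem_J (hp : 2 < p) {n : ℕ} (hn : 2 ≤ n) {f : Aut p} (hf : f ∈ S21 p)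
    (hfn : (f : End p) - 1 ∈ J p n) :
    ∃ g ∈ S21 p, ∃ h ∈ S21 p, (f : End p) - (⁅g, h⁆ : Aut p) ∈ J p (n + 1) := by
  have h2 := two_ne_zero_of_lt hp
  obtain ⟨r, hr⟩ := mem_J.1 hfn
  have hfr : (f : End p) = 1 + r * frob p ^ n := by rw [← hr]; abel
  suffices h : ∃ g ∈ S21 p, ∃ h ∈ S21 p, ∃ s, ((⁅g, h⁆ : Aut p) : End p) - 1 = s * frob p ^ n ∧
      reduction p s = reduction p r by
    obtain ⟨g, hg, h, hh, s, hs, hs'⟩ := h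
    refine ⟨g, hg, h, hh, ?_⟩
    have e : (f : End p) - (⁅g, h⁆ : Aut p) = (r - s) * frob p ^ n := by
      rw [sub_mul, ← hr, ← hs]; abel
    rw [e, add_comm, mul_frob_pow_mem_J, mem_J_one, map_sub, hs', sub_self]
  rcases Nat.even_or_odd n with hev | hodd
  · obtain ⟨k, rfl⟩ := hev.two_dvd
    have htr := pow_eq_neg_of_mem_S21 hf (by omega) hfr
    have hodd : Odd (2 * k - 1) := ⟨k - 1, by omega⟩
    -- for `a` of trace zero, `a / 2 - (a / 2) ^ p = a`
    obtain ⟨g, hg, x, hgx, hx⟩ := exists_mem_S21_of_odd odd_one (reduction p r / 2)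
    obtain ⟨h, hh, y, hhy, hy⟩ := exists_mem_S21_of_odd hodd (1 : Fq p)
    obtain ⟨s, hs, hs'⟩ := exists_commutator_one_add g h one_ne_zero (by omega) x y hgx hhy
    rw [show 1 + (2 * k - 1) = 2 * k by omega] at hs
    refine ⟨g, hg, h, hh, s, hs, ?_⟩
    rw [hs', hx, hy, one_pow, pow_pow_of_odd _ hodd, div_two_pow_char, htr]
    field_simp
    ring
  · -- a nonzero `b` of trace zero; the commutator of `a` and `b` has leading term `-2 a b`
    obtain ⟨ω, hω⟩ := exists_pow_ne_self p
    have hb0 : ω - ω ^ p ≠ 0 := sub_ne_zero.2 hω.symm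
    have hb : (ω - ω ^ p) ^ p = -(ω - ω ^ p) := by
      rw [sub_pow_char, ← pow_mul, ← pow_two, pow_sq_eq_self]; ring
    set b := ω - ω ^ p
    have hodd' : Odd (n - 2) := Nat.Odd.sub_even hn hodd even_two
    obtain ⟨g, hg, x, hgx, hx⟩ := exists_mem_S21_of_odd hodd' (-(reduction p r / (2 * b)))
    obtain ⟨h, hh, y, hhy, hy⟩ := exists_mem_S21_two hp hb
    obtain ⟨s, hs, hs'⟩ := exists_commutator_one_add g h hodd'.pos.ne' two_ne_zero x y hgx hhy
    rw [Nat.sub_add_cancel hn] at hs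
    refine ⟨g, hg, h, hh, s, hs, ?_⟩
    rw [hs', hx, hy, pow_pow_of_odd _ hodd', hb, pow_sq_eq_self]
    field_simp
    ring

/-- Every neighbourhood of `1` in `S₂¹` contains a step of the filtration. In the topology of the unit
group the inverses have to be close to `1` as well, which is automatic here. -/
theorem exists_forall_mem_of_mem_nhds_one {s : Set (S21 p)} (hs : s ∈ nhds 1) :
    ∃ N, ∀ f : S21 p, ((f : Aut p) : End p) - 1 ∈ J p N → f ∈ s := by
  rw [nhds_subtype_eq_comap, Filter.mem_comap] at hs
  obtain ⟨t, ht, hts⟩ := hs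
  rw [Units.isInducing_embedProduct.nhds_eq_comap, Filter.mem_comap] at ht
  obtain ⟨u, hu, hut⟩ := ht
  obtain ⟨v, hv, w, hw, hvw⟩ := mem_nhds_prod_iff.1 hu
  obtain ⟨m, hm⟩ := (Endo.mem_nhds_iff _ _).1 hv
  obtain ⟨n, hn⟩ := (Endo.mem_nhds_iff _ _).1 (MulOpposite.continuous_op.continuousAt hw)
  have hlt : ∀ k, k ≤ p ^ k := fun k => (Nat.lt_pow_self (Fact.out (p := p.Prime)).one_lt).le
  refine ⟨max m n, fun f hf => hts (hut (hvw ⟨hm _ ?_, hn _ ?_⟩))⟩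
  · exact (pow_dvd_pow _ (hlt m)).trans (sub_mem_J_iff.1 (J_anti (le_max_left m n) hf))
  · have h : ((f⁻¹ : S21 p) : Aut p).val - 1 ∈ J p (max m n) := by
      have := (J p (max m n)).mul_mem_left (-((f⁻¹ : S21 p) : Aut p).val) hf
      rwa [neg_mul, mul_sub, mul_one, InvMemClass.coe_inv, Units.inv_mul, neg_sub] at this
    exact (pow_dvd_pow _ (hlt n)).trans (sub_mem_J_iff.1 (J_anti (le_max_right m n) h))

open ContCohomology

/-- A continuous homomorphism from `S₂¹` to a field of characteristic `p` vanishes on the second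
step of the filtration. -/
theorem H1_eq_zero_of_mem_J_two (hp : 2 < p) (φ : H1 (Fq p) (S21 p)) {f : S21 p}
    (hf : ((f : Aut p) : End p) - 1 ∈ J p 2) : φ.1 f = 0 := by
  have h1 : φ.1 1 = 0 := by simpa using H1.map_mul φ 1 1
  obtain ⟨N, hN⟩ := exists_forall_mem_of_mem_nhds_one
    (((IsLocallyConstant.iff_eventually_eq _).1 φ.1.isLocallyConstant) 1)
  have hinv : ∀ g, φ.1 g⁻¹ = -φ.1 g := fun g => by
    have := H1.map_mul φ g⁻¹ g
    rw [inv_mul_cancel, h1] at this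
    linear_combination -this
  -- dividing by commutators moves `f` down the filtration, to where `φ` vanishes by continuity
  have key : ∀ j n, 2 ≤ n → N ≤ n + j → ∀ f : S21 p, ((f : Aut p) : End p) - 1 ∈ J p n →
      φ.1 f = 0 := by
    intro j
    induction j with
    | zero => exact fun n _ hn f hf => (hN f (J_anti hn hf)).trans h1
    | succ j ih =>
      intro n hn hNn f hf
      obtain ⟨g, hg, h, hh, hgh⟩ := exists_commutator_sub_mem_J hp hn f.2 hf
      set k : S21 p := ⁅(⟨g, hg⟩ : S21 p), (⟨h, hh⟩ : S21 p)⁆ with hk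
      have hk0 : φ.1 k = 0 := by
        rw [hk, commutatorElement_def, H1.map_mul, H1.map_mul, H1.map_mul, hinv, hinv]
        ring
      have hkv : (k : Aut p) = ⁅g, h⁆ := rfl
      have h3 : φ.1 (f * k⁻¹) = 0 := by
        refine ih (n + 1) (by omega) (by omega) _ ?_
        have := (J p (n + 1)).mul_mem_right (((k⁻¹ : S21 p) : Aut p) : End p) hgh
        rwa [sub_mul, ← hkv, InvMemClass.coe_inv, Units.mul_inv] at this
      rw [H1.map_mul, hinv, hk0, neg_zero, _root_.add_zero] at h3
      exact h3
  exact key N 2 le_rfl (by omega) f hf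

end Morava

namespace Morava

open FormalGroup ContCohomology

variable {p : ℕ} [Fact p.Prime]

/-! ### Expansions in powers of the Frobenius -/

theorem exists_eq_scalar_add (f : End p) :
    ∃ g : End p, f = scalar p (reduction p f) + g * frob p := by
  obtain ⟨g, hg⟩ := exists_eq_mul_frob p (f - scalar p (reduction p f))
    (show reduction p _ = 0 by simp)
  exact ⟨g, by rw [← hg]; abel⟩

/-- The endomorphism `g` in the expansion `f = a₀ x +_Γ g(x ^ p)`. -/
def tail (f : End p) : End p := (exists_eq_scalar_add f).choose

theorem eq_scalar_add_tail (f : End p) : f = scalar p (reduction p f) + tail f * frob p :=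
  (exists_eq_scalar_add f).choose_spec

theorem tail_eq {f g : End p} {a : Fq p} (h : f = scalar p a + g * frob p) : tail f = g := by
  have ha : reduction p f = a := by rw [h]; simp
  have h' := eq_scalar_add_tail f
  rw [ha] at h'
  exact mul_frob_injective p (add_left_cancel (h'.symm.trans h))

/-- The coefficient `aₙ` in the expansion `f(x) = a₀ x +_Γ a₁ x ^ p +_Γ a₂ x ^ (p ^ 2) +_Γ ⋯`. -/
def digit (n : ℕ) (f : End p) : Fq p := reduction p (tail^[n] f)

theorem digit_zero (f : End p) : digit 0 f = reduction p f := rfl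

theorem digit_succ (n : ℕ) (f : End p) : digit (n + 1) f = digit n (tail f) := by
  rw [digit, Function.iterate_succ_apply, digit]

theorem digit_congr {n : ℕ} {f g : End p} (h : f - g ∈ J p (n + 1)) : digit n f = digit n g := by
  have h0 : reduction p f = reduction p g := by
    have := mem_J_one.1 (J_anti (Nat.le_add_left 1 n) h)
    rwa [map_sub, sub_eq_zero] at this
  induction n generalizing f g with
  | zero => exact h0
  | succ n ih =>
    have h1 : tail f - tail g ∈ J p (n + 1) := by
      rw [eq_scalar_add_tail f, eq_scalar_add_tail g, h0, add_sub_add_left_eq_sub, ← sub_mul] at h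
      exact (mul_frob_pow_mem_J (n := 1)).1 (by simpa using h)
    rw [digit_succ, digit_succ]
    refine ih h1 ?_
    have := mem_J_one.1 (J_anti (Nat.le_add_left 1 n) h1)
    rwa [map_sub, sub_eq_zero] at this

theorem sub_sum_digit_mem_J (n : ℕ) (f : End p) :
    f - ∑ i ∈ Finset.range n, scalar p (digit i f) * frob p ^ i ∈ J p n := by
  induction n generalizing f with
  | zero => exact mem_J.2 ⟨_, by rw [pow_zero, mul_one]⟩
  | succ n ih =>
    have h : f - ∑ i ∈ Finset.range (n + 1), scalar p (digit i f) * frob p ^ i =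
        (tail f - ∑ i ∈ Finset.range n, scalar p (digit i (tail f)) * frob p ^ i) * frob p ^ 1 := by
      rw [Finset.sum_range_succ', pow_zero, mul_one, digit_zero, sub_mul, Finset.sum_mul]
      conv_lhs => enter [1]; rw [eq_scalar_add_tail f]
      simp only [digit_succ, pow_succ, pow_zero, one_mul, mul_assoc]
      abel
    rw [h, mul_frob_pow_mem_J]
    exact ih _

theorem digit_sum (a : ℕ → Fq p) {n N : ℕ} (h : n < N) :
    digit n (∑ i ∈ Finset.range N, scalar p (a i) * frob p ^ i) = a n := by
  induction n generalizing a N with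
  | zero =>
    obtain ⟨N, rfl⟩ : ∃ M, N = M + 1 := ⟨N - 1, by omega⟩
    rw [Finset.sum_range_succ', digit_zero]
    simp [map_sum]
  | succ n ih =>
    obtain ⟨N, rfl⟩ : ∃ M, N = M + 1 := ⟨N - 1, by omega⟩
    rw [digit_succ, tail_eq (a := a 0)
      (g := ∑ i ∈ Finset.range N, scalar p (a (i + 1)) * frob p ^ i)]
    · exact ih (fun i => a (i + 1)) (by omega)
    · rw [Finset.sum_range_succ', Finset.sum_mul, add_comm]
      simp only [pow_succ, pow_zero, mul_one, mul_assoc]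

theorem series_frob_pow (n : ℕ) : (frob p ^ n).series = PowerSeries.X ^ p ^ n := by
  induction n with
  | zero => simp
  | succ n ih => rw [pow_succ', frob_mul_series, ih, ← pow_mul, ← pow_succ]

theorem monomialPoint_val {R : Type*} [CommRing R] (F : FormalGroup R) (a : R) {m : ℕ}
    (hm : m ≠ 0) : (F.monomialPoint a m).val = PowerSeries.monomial m a :=
  congrArg Subtype.val (dif_neg hm)

theorem series_scalar_mul_frob_pow (a : Fq p) (n : ℕ) :
    (scalar p a * frob p ^ n).series = ((Gam p).monomialPoint a (p ^ n)).val := by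
  have hs : PowerSeries.HasSubst (frob p ^ n).series := (frob p ^ n).hasSubst
  rw [Endo.series_mul]
  change (a • PowerSeries.X : PowerSeries (Fq p)).subst (frob p ^ n).series = _
  rw [PowerSeries.subst_smul hs, PowerSeries.subst_X hs, series_frob_pow, PowerSeries.X_pow_eq,
    monomialPoint_val _ a (pow_ne_zero _ (Fact.out (p := p.Prime)).ne_zero), ← map_smul, smul_eq_mul, mul_one]

theorem series_sum_scalar (a : ℕ → Fq p) (N : ℕ) :
    (∑ i ∈ Finset.range N, scalar p (a i) * frob p ^ i).series =
      (∑ i ∈ Finset.range N, (Gam p).monomialPoint (a i) (p ^ i) : (Gam p).Point Unit).val := by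
  induction N with
  | zero => rfl
  | succ N ih =>
    rw [Finset.sum_range_succ, Finset.sum_range_succ, FormalGroup.add_apply, ← ih,
      ← series_scalar_mul_frob_pow]
    rfl

theorem isExpansion_digit (f : End p) : (Gam p).IsExpansion p f.series fun n => digit n f := by
  intro n
  filter_upwards [Filter.eventually_ge_atTop n] with N hN
  have h := PowerSeries.X_pow_dvd_iff.1 (sub_mem_J_iff.1 (sub_sum_digit_mem_J N f)) n
    (hN.trans_lt (Nat.lt_pow_self (Fact.out (p := p.Prime)).one_lt))
  rw [map_sub, sub_eq_zero, series_sum_scalar] at h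
  exact h.symm

/-- The coefficients of an expansion are uniquely determined. -/
theorem digit_eq_of_isExpansion {f : End p} {a : ℕ → Fq p}
    (h : (Gam p).IsExpansion p f.series a) (n : ℕ) : digit n f = a n := by
  have h1 : ∀ᶠ N in Filter.atTop, ∀ m ∈ Finset.range (p ^ (n + 1)), PowerSeries.coeff m
      (∑ i ∈ Finset.range N, (Gam p).monomialPoint (a i) (p ^ i) : (Gam p).Point Unit).val =
        PowerSeries.coeff m f.series :=
    (Filter.eventually_all_finset _).2 fun m _ => h m
  obtain ⟨N, hN, hnN⟩ := (h1.and (Filter.eventually_gt_atTop n)).exists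
  rw [← digit_sum a hnN]
  refine digit_congr (sub_mem_J_iff.2 (PowerSeries.X_pow_dvd_iff.2 fun m hm => ?_))
  rw [map_sub, sub_eq_zero, series_sum_scalar]
  exact (hN m (Finset.mem_range.2 hm)).symm

/-- Carries in a formal sum affect only coefficients from degree two on. -/
theorem digit_one_add (f g : End p) : digit 1 (f + g) = digit 1 f + digit 1 g := by
  obtain ⟨c, hc⟩ := mem_J.1 (scalar_add_mem_J (reduction p f) (reduction p g))
  have h : f + g = scalar p (reduction p f + reduction p g) +
      (c * frob p + (tail f + tail g)) * frob p := by
    conv_lhs => rw [eq_scalar_add_tail f, eq_scalar_add_tail g]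
    rw [add_mul, mul_assoc c, ← pow_two, ← hc, add_mul]
    abel
  simp only [digit_succ, digit_zero, tail_eq h]
  simp

theorem digit_one_mul_frob (f : End p) : digit 1 (f * frob p) = reduction p f := by
  have h : f * frob p = scalar p 0 + f * frob p := by rw [scalar_zero, _root_.zero_add]
  rw [digit_succ, digit_zero, tail_eq h]

theorem eq_one_add_tail {f : End p} (hf : reduction p f = 1) : f = 1 + tail f * frob p := by
  have := eq_scalar_add_tail f
  rwa [hf, scalar_one] at this

/-- The product of two strict automorphisms, up to multiples of the Frobenius. -/
theorem exists_tail_mul {f g : End p} (hf : reduction p f = 1) (hg : reduction p g = 1) :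
    ∃ g', tail (f * g) = tail f + tail g + tail f * g' * frob p ∧
      reduction p g' = digit 1 g ^ p := by
  obtain ⟨g', hg', hr⟩ := exists_frob_mul p (tail g)
  refine ⟨g', tail_eq (a := 1) ?_, hr⟩
  conv_lhs => rw [eq_one_add_tail hf, eq_one_add_tail hg]
  have e : tail f * frob p * (tail g * frob p) = tail f * g' * frob p * frob p := by
    rw [mul_assoc, ← mul_assoc (frob p), hg']; simp only [mul_assoc]
  rw [mul_add, add_mul, add_mul (1 : End p), e, scalar_one]
  noncomm_ring

theorem digit_one_mul {f g : End p} (hf : reduction p f = 1) (hg : reduction p g = 1) :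
    digit 1 (f * g) = digit 1 f + digit 1 g := by
  obtain ⟨g', h, -⟩ := exists_tail_mul hf hg
  rw [digit_succ, h, digit_zero]
  simp [digit_succ, digit_zero]

theorem digit_two_mul {f g : End p} (hf : reduction p f = 1) (hg : reduction p g = 1) :
    digit 2 (f * g) = digit 2 f + digit 2 g + digit 1 f * digit 1 g ^ p := by
  obtain ⟨g', h, hr⟩ := exists_tail_mul hf hg
  rw [digit_succ, h, digit_one_add, digit_one_add, digit_one_mul_frob, map_mul, hr]
  simp only [digit_succ, digit_zero]

/-! ### The cohomology of `S₂¹` -/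

theorem reduction_of_mem_S21 (f : S21 p) : reduction p (f : Aut p).val = 1 :=
  (mem_S21_iff.1 f.2).1

theorem isLocallyConstant_digit (n : ℕ) :
    IsLocallyConstant fun f : S21 p => digit n (f : Aut p).val := by
  rw [IsLocallyConstant.iff_eventually_eq]
  intro f
  have hc : Continuous fun f : S21 p => ((f : Aut p) : End p) :=
    Units.continuous_val.comp continuous_subtype_val
  filter_upwards [hc.continuousAt (Endo.nhds_mem ((f : Aut p) : End p) (p ^ (n + 1)))] with g hg
  exact digit_congr (sub_mem_J_iff.2 hg)

/-- The cocycle `τ₁`, sending `f` to its coefficient `a₁`. -/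
def tau₁ (p : ℕ) [Fact p.Prime] : H1 (Fq p) (S21 p) :=
  ⟨⟨fun f => digit 1 (f : Aut p).val, isLocallyConstant_digit 1⟩, by
    rw [LinearMap.mem_ker]
    ext ⟨g, h⟩
    rw [d₁_apply]
    change digit 1 _ - digit 1 ((g : Aut p).val * (h : Aut p).val) + digit 1 _ = 0
    rw [digit_one_mul (reduction_of_mem_S21 g) (reduction_of_mem_S21 h)]
    ring⟩

theorem tau₁_apply (f : S21 p) : (tau₁ p).1 f = digit 1 (f : Aut p).val := rfl

/-- The cocycle `τ₂`, the Frobenius conjugate of `τ₁`. -/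
def tau₂ (p : ℕ) [Fact p.Prime] : H1 (Fq p) (S21 p) :=
  ⟨(tau₁ p).1.map (· ^ p), by
    rw [LinearMap.mem_ker]
    ext ⟨g, h⟩
    rw [d₁_apply]
    change (tau₁ p).1 h ^ p - (tau₁ p).1 (g * h) ^ p + (tau₁ p).1 g ^ p = 0
    rw [H1.map_mul, add_pow_char]
    ring⟩

theorem tau₂_apply (f : S21 p) : (tau₂ p).1 f = digit 1 (f : Aut p).val ^ p := rfl

/-- The cochain `σ`, sending `f` to its coefficient `a₂`. -/
def sigma (p : ℕ) [Fact p.Prime] : LocallyConstant (S21 p) (Fq p) :=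
  ⟨fun f => digit 2 (f : Aut p).val, isLocallyConstant_digit 2⟩

theorem d₁_sigma : d₁ (Fq p) (sigma p) = -(cupCochain (tau₁ p) (tau₂ p)).val := by
  ext ⟨g, h⟩
  rw [d₁_apply]
  change digit 2 _ - digit 2 ((g : Aut p).val * (h : Aut p).val) + digit 2 _ =
    -(digit 1 (g : Aut p).val * digit 1 (h : Aut p).val ^ p)
  rw [digit_two_mul (reduction_of_mem_S21 g) (reduction_of_mem_S21 h)]
  ring

theorem cup_tau : cup (tau₁ p) (tau₂ p) = 0 := by
  rw [cup, Submodule.Quotient.mk_eq_zero, Submodule.mem_comap, LinearMap.mem_range]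
  exact ⟨-sigma p, by rw [map_neg, d₁_sigma, neg_neg]; rfl⟩

theorem digit_one_conj (a : (Fq p)ˣ) (f : S21 p) :
    digit 1 (conj p (scalarUnit p a) f : Aut p).val =
      (a : Fq p) ^ (p - 1) * digit 1 (f : Aut p).val := by
  have hp := (Fact.out (p := p.Prime)).pos
  have ha : ((scalarUnit p a)⁻¹ : Aut p).val = scalar p (a⁻¹ : (Fq p)ˣ) := by
    rw [← map_inv]; rfl
  have ha' : (scalarUnit p a).val = scalar p a := rfl
  have h1 : scalar p (a⁻¹ : (Fq p)ˣ) * scalar p a = 1 := by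
    rw [← scalar_mul, Units.inv_mul, scalar_one]
  have h : (conj p (scalarUnit p a) f : Aut p).val =
      scalar p 1 + (scalar p (a⁻¹ : (Fq p)ˣ) * tail (f : Aut p).val * scalar p (a ^ p)) *
        frob p := by
    rw [conj_apply, Units.val_mul, Units.val_mul, ha, ha']
    conv_lhs => rw [eq_one_add_tail (reduction_of_mem_S21 f)]
    rw [mul_add, add_mul, mul_one, h1, scalar_one]
    simp only [mul_assoc, frob_mul_scalar]
  rw [digit_succ, tail_eq h, digit_zero, digit_succ, digit_zero]
  simp only [map_mul, reduction_scalar]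
  have e : (a : Fq p) ^ p = (a : Fq p) ^ (p - 1) * a := by
    rw [← pow_succ, Nat.sub_add_cancel hp]
  rw [e]
  simp only [Units.val_inv_eq_inv_val]
  field_simp

theorem H1Rep_tau₁ (a : (Fq p)ˣ) : H1Rep p a (tau₁ p) = (a : Fq p) ^ (p - 1) • tau₁ p :=
  Subtype.ext (LocallyConstant.ext fun f => digit_one_conj a f)

theorem H1Rep_tau₂ (a : (Fq p)ˣ) : H1Rep p a (tau₂ p) = (a : Fq p) ^ (p ^ 2 - p) • tau₂ p := by
  refine Subtype.ext (LocallyConstant.ext fun f => ?_)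
  change digit 1 (conj p (scalarUnit p a) f : Aut p).val ^ p =
    (a : Fq p) ^ (p ^ 2 - p) * digit 1 (f : Aut p).val ^ p
  rw [digit_one_conj, mul_pow, ← pow_mul, Nat.sub_mul, one_mul, pow_two]

/-- An additive map on the field with `p ^ 2` elements that vanishes at `1` and at some `ω` outside
the prime field is zero. -/
theorem eq_zero_of_map_eq_zero (M : Fq p →+ Fq p) {ω : Fq p} (hω : ω ^ p ≠ ω) (h1 : M 1 = 0)
    (h2 : M ω = 0) : M = 0 := by
  have hp := (Fact.out (p := p.Prime))
  have hone : (1 : Fq p) ∈ M.ker := h1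
  have hle : AddSubgroup.zmultiples (1 : Fq p) ≤ M.ker := by
    rwa [AddSubgroup.zmultiples_le]
  have hc1 : Nat.card (AddSubgroup.zmultiples (1 : Fq p)) = p := by
    rw [Nat.card_zmultiples]
    exact CharP.eq (Fq p) (CharP.addOrderOf_one (Fq p)) inferInstance
  have hlt : AddSubgroup.zmultiples (1 : Fq p) < M.ker := by
    refine lt_of_le_of_ne hle fun h => hω ?_
    have : ω ∈ AddSubgroup.zmultiples (1 : Fq p) := h ▸ h2
    obtain ⟨n, rfl⟩ := AddSubgroup.mem_zmultiples_iff.1 this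
    have := map_zsmul (frobenius (Fq p) p) n 1
    rwa [map_one, frobenius_def] at this
  have hq : Nat.card (Fq p) = p ^ 2 := GaloisField.card p 2 two_ne_zero
  have hd := AddSubgroup.card_addSubgroup_dvd_card M.ker
  rw [hq] at hd
  obtain ⟨k, hk, hk'⟩ := (Nat.dvd_prime_pow hp).1 hd
  have hk2 : ¬ k ≤ 1 := fun hk1 => hlt.ne (AddSubgroup.eq_of_le_of_card_ge hle (by
    rw [hc1, hk']
    simpa using Nat.pow_le_pow_right hp.pos hk1))
  have htop : M.ker = ⊤ := AddSubgroup.eq_top_of_card_eq _ (by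
    rw [hk', hq, show k = 2 by omega])
  ext x
  have : x ∈ M.ker := htop ▸ AddSubgroup.mem_top x
  exact this

/-- Over the field with `p ^ 2` elements, the additive maps are the linear combinations of the
identity and the Frobenius. -/
theorem exists_eq_mul_add_mul_pow (M : Fq p →+ Fq p) :
    ∃ c₁ c₂ : Fq p, ∀ x, M x = c₁ * x + c₂ * x ^ p := by
  obtain ⟨ω, hω⟩ := exists_pow_ne_self p
  have hd : ω ^ p - ω ≠ 0 := sub_ne_zero.2 hω
  -- the coefficients are determined by the values at `1` and `ω`
  set c₂ := (M ω - M 1 * ω) / (ω ^ p - ω) with hc₂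
  set c₁ := M 1 - c₂ with hc₁
  let L : Fq p →+ Fq p := M - (AddMonoidHom.mulLeft c₁ +
    (AddMonoidHom.mulLeft c₂).comp (frobenius (Fq p) p).toAddMonoidHom)
  have hL : ∀ x, L x = M x - (c₁ * x + c₂ * x ^ p) := fun x => rfl
  have h0 : L = 0 := eq_zero_of_map_eq_zero L hω (by rw [hL, hc₁]; simp) (by
    rw [hL, hc₁, hc₂]
    field_simp
    ring)
  refine ⟨c₁, c₂, fun x => ?_⟩
  have := hL x
  rw [h0, AddMonoidHom.zero_apply] at this
  linear_combination -this

theorem exists_digit_one_eq (a : Fq p) : ∃ f : S21 p, digit 1 (f : Aut p).val = a := by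
  obtain ⟨f, hf, r, hr, ha⟩ := exists_mem_S21_of_odd odd_one a
  refine ⟨⟨f, hf⟩, ?_⟩
  rw [digit_succ, tail_eq (a := 1) (g := r) (by rw [scalar_one, hr, pow_one]), digit_zero, ha]

/-- A cocycle depends only on the coefficient `a₁`. -/
theorem H1_congr (hp : 2 < p) (φ : H1 (Fq p) (S21 p)) {f g : S21 p}
    (h : digit 1 (f : Aut p).val = digit 1 (g : Aut p).val) : φ.1 f = φ.1 g := by
  have hfg : (f : Aut p).val - (g : Aut p).val ∈ J p 2 := by
    rw [eq_one_add_tail (reduction_of_mem_S21 f), eq_one_add_tail (reduction_of_mem_S21 g),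
      add_sub_add_left_eq_sub, ← sub_mul]
    have h1 : tail (f : Aut p).val - tail (g : Aut p).val ∈ J p 1 := by
      rw [digit_succ, digit_succ, digit_zero, digit_zero] at h
      rw [mem_J_one, map_sub, h, sub_self]
    simpa using (mul_frob_pow_mem_J (n := 1)).2 h1
  have h0 : φ.1 (f * g⁻¹) = 0 := by
    refine H1_eq_zero_of_mem_J_two hp φ ?_
    have := (J p 2).mul_mem_right ((g⁻¹ : S21 p) : Aut p).val hfg
    rwa [sub_mul, InvMemClass.coe_inv, Units.mul_inv] at this
  have := H1.map_mul φ (f * g⁻¹) g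
  rwa [inv_mul_cancel_right, h0, _root_.zero_add] at this

/-- The linear map sending `(c₁, c₂)` to `c₁ τ₁ + c₂ τ₂`. -/
def tauMap (p : ℕ) [Fact p.Prime] : Fq p × Fq p →ₗ[Fq p] H1 (Fq p) (S21 p) :=
  (LinearMap.toSpanSingleton (Fq p) _ (tau₁ p)).coprod
    (LinearMap.toSpanSingleton (Fq p) _ (tau₂ p))

theorem tauMap_apply (c : Fq p × Fq p) : tauMap p c = c.1 • tau₁ p + c.2 • tau₂ p := by
  simp [tauMap]

theorem tauMap_apply_apply (c : Fq p × Fq p) (f : S21 p) : (tauMap p c).1 f =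
    c.1 * digit 1 (f : Aut p).val + c.2 * digit 1 (f : Aut p).val ^ p := by
  rw [tauMap_apply]
  rfl

theorem tauMap_injective : Function.Injective (tauMap p) := by
  rw [injective_iff_map_eq_zero]
  intro c hc
  have h : ∀ a : Fq p, c.1 * a + c.2 * a ^ p = 0 := fun a => by
    obtain ⟨f, rfl⟩ := exists_digit_one_eq a
    rw [← tauMap_apply_apply, hc]
    rfl
  obtain ⟨ω, hω⟩ := exists_pow_ne_self p
  have h1 := h 1
  rw [one_pow, mul_one, mul_one] at h1
  have h2 : c.2 * (ω ^ p - ω) = 0 := by linear_combination h ω - ω * h1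
  have h3 : c.2 = 0 := (mul_eq_zero.1 h2).resolve_right (sub_ne_zero.2 hω)
  exact Prod.ext (by simpa [h3] using h1) h3

theorem tauMap_surjective (hp : 2 < p) : Function.Surjective (tauMap p) := by
  intro φ
  choose s hs using exists_digit_one_eq (p := p)
  let M : Fq p →+ Fq p := AddMonoidHom.mk' (fun a => φ.1 (s a)) fun a b => by
    rw [← H1.map_mul]
    refine H1_congr hp φ ?_
    rw [hs, Subgroup.coe_mul, Units.val_mul,
      digit_one_mul (reduction_of_mem_S21 _) (reduction_of_mem_S21 _), hs, hs]
  obtain ⟨c₁, c₂, hc⟩ := exists_eq_mul_add_mul_pow M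
  refine ⟨(c₁, c₂), Subtype.ext (LocallyConstant.ext fun f => ?_)⟩
  rw [tauMap_apply_apply, ← hc]
  exact H1_congr hp φ (hs _)

/-- The isomorphism `𝔽(p - 1) ⊕ 𝔽(p ^ 2 - p) ≅ H¹(S₂¹)` given by `τ₁` and `τ₂`. -/
def tauEquiv (hp : 2 < p) :
    ((twist p (p - 1)).prod (twist p (p ^ 2 - p))).Equiv (H1Rep p) :=
  .mk (LinearEquiv.ofBijective (tauMap p) ⟨tauMap_injective, tauMap_surjective hp⟩) fun a => by
    refine LinearMap.ext fun c => ?_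
    change tauMap p ((a : Fq p) ^ (p - 1) * c.1, (a : Fq p) ^ (p ^ 2 - p) * c.2) =
      H1Rep p a (tauMap p c)
    rw [tauMap_apply, tauMap_apply, map_add, map_smul, map_smul, H1Rep_tau₁, H1Rep_tau₂, smul_smul,
      smul_smul, mul_comm, mul_comm _ c.2]

theorem tauEquiv_apply (hp : 2 < p) (c : Fq p × Fq p) : tauEquiv hp c = tauMap p c := rfl

end Morava

end

theorem mainTheorem4 (p : ℕ) [Fact p.Prime] (hp : 2 < p) :
    ∃ (τ₁ τ₂ : ContCohomology.H1 (Morava.Fq p) (Morava.S21 p))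
      (σ : LocallyConstant (Morava.S21 p) (Morava.Fq p)),
      (∀ f : Morava.S21 p,
        (∃ a : ℕ → Morava.Fq p,
          (Morava.Gam p).IsExpansion p (f : Morava.Aut p).val.series a) ∧
        ∀ a : ℕ → Morava.Fq p, (Morava.Gam p).IsExpansion p (f : Morava.Aut p).val.series a →
          τ₁.val f = a 1 ∧ τ₂.val f = a 1 ^ p ∧ σ f = a 2) ∧
      (∃ e : Representation.Equiv
          ((Morava.twist p (p - 1)).prod (Morava.twist p (p ^ 2 - p))) (Morava.H1Rep p),
        e (1, 0) = τ₁ ∧ e (0, 1) = τ₂) ∧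
      ContCohomology.cup τ₁ τ₂ = 0 ∧
      ContCohomology.d₁ (Morava.Fq p) σ = -(ContCohomology.cupCochain τ₁ τ₂).val := by
  refine ⟨Morava.tau₁ p, Morava.tau₂ p, Morava.sigma p,
    fun f => ⟨⟨_, Morava.isExpansion_digit _⟩, fun a ha => ?_⟩,
    ⟨Morava.tauEquiv hp, ?_, ?_⟩, Morava.cup_tau, Morava.d₁_sigma⟩
  · rw [Morava.tau₁_apply, Morava.tau₂_apply, Morava.digit_eq_of_isExpansion ha]
    exact ⟨rfl, rfl, Morava.digit_eq_of_isExpansion ha 2⟩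
  · rw [Morava.tauEquiv_apply, Morava.tauMap_apply, one_smul, zero_smul, _root_.add_zero]
  · rw [Morava.tauEquiv_apply, Morava.tauMap_apply, one_smul, zero_smul, _root_.zero_add]
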